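/- Let $k$ be an algebraically closed field of characteristic $0$, let $A$ be a finitely generated commutative unital $k$-algebra, $X=\operatorname{Spec}A$, let $\mathfrak g$ be a finite-dimensional reductive Lie algebra over $k$, and let $\Gamma$ be a finite group acting on $X$ (equivalently, on the $k$-algebra $A$) and on $\mathfrak g$ by automorphisms. Let $\mathfrak M=M(X,\mathfrak g)^\Gamma=(\mathfrak g\otimes A)^\Gamma$ be the Lie algebra of $\Gamma$-equivariant regular maps $X\to\mathfrak g$, and $\mathfrak M_{ab}=\mathfrak M/[\mathfrak M,\mathfrak M]$. Let $X_{rat}$ be the set of rational points of $X$. For $x\in X_{rat}$ let $\mathfrak g^x$ be the subalgebra of $\mathfrak g$ fixed by the isotropy group $\Gamma_x$, and regard every $\mathfrak g^x$-module as an $\mathfrak M$-module (an evaluation module at $x$) via $\alpha\mapsto\alpha(x)\in\mathfrak g^x$. Let $X_*$ be the set of finite subsets $\mathbf x\subseteq X_{rat}$ whose distinct points have disjoint $\Gamma$-orbits. Let $\mathcal E$ be the set of functions $\psi$ assigning to each $x\in X_{rat}$ an isomorphism class $\psi(x)$ of irreducible finite-dimensional $\mathfrak g^x$-modules such that $\psi(\gamma\cdot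 x)=[\rho\circ\gamma^{-1}]$ whenever $\psi(x)=[\rho]$, and such that $\operatorname{Supp}\psi$, the set of $x$ at which $\psi(x)$ is not the class of the one-dimensional trivial module, is finite. An $\mathfrak M$-module corresponds to $\psi\in\mathcal E$ if it is isomorphic to $\bigotimes_{y\in\mathbf y}W_y$, where $\mathbf y\in X_*$ consists of one point of each $\Gamma$-orbit in $\operatorname{Supp}\psi$ and $W_y$ is an evaluation module at $y$ attached to a $\mathfrak g^y$-module in the class $\psi(y)$. For $\mathfrak M$-modules $U,W$, let $\operatorname{Ext}^1_{\mathfrak M}(U,W)$ be the $k$-vector space of equivalence classes of extensions $0\to W\to E\to U\to 0$. **Theorem 3.8.** Let $\mathbf x\in X_*$ and let $V=\bigotimes_{x\in\mathbf x}V_x$ and $V'=\bigotimes_{x\in\mathbf x}V'_x$, where $V_x,V'_x$ are (possibly trivial) irreducible finite-dimensional evaluation modules at $x$, and suppose that $V$ and $V'$ correspond to $\psi,\psi'\in\mathcal E$ respectively. 1. If $\psi$ and $\psi'$ differ on more than one $\Gamma$-orbit, then $\operatorname{Ext}^1_{\mathfrak M}(V,V')=0$. 2. If $\psi$ and $\psi'$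 differ on exactly one orbit $\Gamma\cdot x_0$, $x_0\in\mathbf x$, then $\operatorname{Ext}^1_{\mathfrak M}(V,V')\cong\operatorname{Ext}^1_{\mathfrak M}(V_{x_0},V'_{x_0})$. 3. If $\psi=\psi'$, then $V\cong V'$ as $\mathfrak M$-modules, and if moreover $\mathbf x\neq\varnothing$, then $$(\mathfrak M_{ab}^*)^{|\mathbf x|-1}\oplus\operatorname{Ext}^1_{\mathfrak M}(V,V)\cong\bigoplus_{x\in\mathbf x}\operatorname{Ext}^1_{\mathfrak M}(V_x,V_x).$$ The isomorphisms of $\operatorname{Ext}^1$ spaces are isomorphisms of $k$-vector spaces. -/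

import Mathlib

open scoped TensorProduct

universe u v w w₁ w₂

noncomputable section

namespace EMA

/-! ### The first extension space of two modules of a Lie algebra -/

section Ext

variable (k : Type u) (L : Type v) [Field k] [LieRing L] [LieAlgebra k L]
variable (V₁ : Type w₁) [AddCommGroup V₁] [Module k V₁] [LieRingModule L V₁] [LieModule k L V₁]
variable (V₂ : Type w₂) [AddCommGroup V₂] [Module k V₂] [LieRingModule L V₂] [LieModule k L V₂]

/-- A short exact sequence `0 → V₂ → U → V₁ → 0` of `L`-modules. -/
structure ModExt where
  U : Type (max w₁ w₂)
  [acg : AddCommGroup U]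
  [mod : Module k U]
  [lrm : LieRingModule L U]
  [lm : LieModule k L U]
  i : V₂ →ₗ⁅k,L⁆ U
  p : U →ₗ⁅k,L⁆ V₁
  inj : Function.Injective i
  surj : Function.Surjective p
  exact : Function.Exact i p

attribute [instance] ModExt.acg ModExt.mod ModExt.lrm ModExt.lm

variable {k L V₁ V₂} in
/-- Equivalence of extensions: an isomorphism of the middle terms which is the identity on both
ends. -/
def ModExt.Equivalent (E F : ModExt k L V₁ V₂) : Prop :=
  ∃ f : E.U ≃ₗ⁅k,L⁆ F.U, (∀ v, f (E.i v) = F.i v) ∧ ∀ u, F.p (f u) = E.p u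

/-- Equivalence of extensions, as a setoid. -/
instance ModExt.setoid : Setoid (ModExt k L V₁ V₂) where
  r := ModExt.Equivalent
  iseqv :=
    { refl := fun _ => ⟨LieModuleEquiv.refl, fun _ => rfl, fun _ => rfl⟩
      symm := by
        rintro E F ⟨f, h₁, h₂⟩
        refine ⟨f.symm, fun v => ?_, fun u => ?_⟩
        · rw [← h₁, LieModuleEquiv.symm_apply_apply]
        · rw [← h₂, LieModuleEquiv.apply_symm_apply]
      trans := by
        rintro E F G ⟨f, h₁, h₂⟩ ⟨g, h₃, h₄⟩
        refine ⟨f.trans g, fun v => ?_, fun u => ?_⟩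
        · rw [LieModuleEquiv.trans_apply, h₁, h₃]
        · rw [LieModuleEquiv.trans_apply, h₄, h₂] }

/-- `Ext¹_L(V₁, V₂)`: the equivalence classes of extensions `0 → V₂ → U → V₁ → 0`. -/
def Ext1 : Type _ := Quotient (ModExt.setoid k L V₁ V₂)

/-- `H¹(L, W)`: derivations `L → W` modulo inner derivations. -/
abbrev H1 (W : Type w) [AddCommGroup W] [Module k W] [LieRingModule L W] [LieModule k L W] :
    Type _ :=
  LieDerivation k L W ⧸ LinearMap.range (LieDerivation.inner k L W)

variable {k L V₁ V₂}

/-- The space `V₁ ⊕ V₂` with the action `l • (v₁, v₂) = (l • v₁, ∂(l)(v₁) + l • v₂)`. -/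
def Twisted (_D : LieDerivation k L (V₁ →ₗ[k] V₂)) : Type (max w₁ w₂) := V₁ × V₂

namespace Twisted

variable (D : LieDerivation k L (V₁ →ₗ[k] V₂))

instance : AddCommGroup (Twisted D) := inferInstanceAs (AddCommGroup (V₁ × V₂))
instance : Module k (Twisted D) := inferInstanceAs (Module k (V₁ × V₂))

instance : LieRingModule L (Twisted D) where
  bracket l v := ((⁅l, v.1⁆, D l v.1 + ⁅l, v.2⁆) : V₁ × V₂)
  add_lie a b v := by
    refine Prod.ext ?_ ?_
    · exact add_lie a b v.1
    · change D (a + b) v.1 + ⁅a + b, v.2⁆ = (D a v.1 + ⁅a, v.2⁆) + (D b v.1 + ⁅b, v.2⁆)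
      rw [map_add, LinearMap.add_apply, add_lie]; abel
  lie_add a v w := by
    refine Prod.ext ?_ ?_
    · exact lie_add a v.1 w.1
    · change D a (v.1 + w.1) + ⁅a, v.2 + w.2⁆ = (D a v.1 + ⁅a, v.2⁆) + (D a w.1 + ⁅a, w.2⁆)
      rw [map_add, lie_add]; abel
  leibniz_lie a b v := by
    refine Prod.ext ?_ ?_
    · exact leibniz_lie a b v.1
    · change D a ⁅b, v.1⁆ + ⁅a, D b v.1 + ⁅b, v.2⁆⁆ =
        (D ⁅a, b⁆ v.1 + ⁅⁅a, b⁆, v.2⁆) + (D b ⁅a, v.1⁆ + ⁅b, D a v.1 + ⁅a, v.2⁆⁆)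
      rw [LieDerivation.apply_lie_eq_sub, LinearMap.sub_apply, LieHom.lie_apply, LieHom.lie_apply,
        lie_add, lie_add, leibniz_lie a b v.2]
      abel

theorem lie_def (l : L) (v : Twisted D) :
    ⁅l, v⁆ = ((⁅l, v.1⁆, D l v.1 + ⁅l, v.2⁆) : V₁ × V₂) := rfl

instance : LieModule k L (Twisted D) where
  smul_lie t l v := by
    refine Prod.ext ?_ ?_
    · exact smul_lie t l v.1
    · change D (t • l) v.1 + ⁅t • l, v.2⁆ = t • (D l v.1 + ⁅l, v.2⁆)
      rw [map_smul, LinearMap.smul_apply, smul_lie, smul_add]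
  lie_smul t l v := by
    refine Prod.ext ?_ ?_
    · exact lie_smul t l v.1
    · change D l (t • v.1) + ⁅l, t • v.2⁆ = t • (D l v.1 + ⁅l, v.2⁆)
      rw [map_smul, lie_smul, smul_add]

end Twisted

/-- The extension attached to a derivation `L → Hom(V₁, V₂)`. -/
def extOfDer (D : LieDerivation k L (V₁ →ₗ[k] V₂)) : ModExt k L V₁ V₂ where
  U := Twisted D
  i :=
    { LinearMap.inr k V₁ V₂ with
      map_lie' := by
        intro l v
        refine Prod.ext ?_ ?_
        · exact (lie_zero l).symm
        · change ⁅l, v⁆ = D l 0 + ⁅l, v⁆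
          rw [map_zero, zero_add] }
  p := { LinearMap.fst k V₁ V₂ with map_lie' := fun {_ _} => rfl }
  inj := fun _ _ h => congrArg Prod.snd h
  surj := fun v => ⟨(v, 0), rfl⟩
  exact := fun u => ⟨fun h => ⟨u.2, Prod.ext (Eq.symm h) rfl⟩, by rintro ⟨v, rfl⟩; rfl⟩

theorem extOfDer_equivalent_iff (D D' : LieDerivation k L (V₁ →ₗ[k] V₂)) :
    (extOfDer D).Equivalent (extOfDer D') ↔
      D - D' ∈ LinearMap.range (LieDerivation.inner k L (V₁ →ₗ[k] V₂)) := by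
  constructor
  · rintro ⟨f, h₁, h₂⟩
    have e₁ : ∀ v : V₂, f ((0, v) : V₁ × V₂) = ((0, v) : V₁ × V₂) := h₁
    have e₂ : ∀ u : Twisted D, (f u).1 = u.1 := h₂
    let h : V₁ →ₗ[k] V₂ :=
      LinearMap.snd k V₁ V₂ ∘ₗ
        (show (V₁ × V₂) →ₗ[k] (V₁ × V₂) from f.toLinearEquiv.toLinearMap) ∘ₗ LinearMap.inl k V₁ V₂
    have hh : ∀ v : V₁, (f ((v, 0) : V₁ × V₂)).2 = h v := fun _ => rfl
    have e₃ : ∀ u : Twisted D, (f u).2 = h u.1 + u.2 := by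
      intro u
      have hu : u = (show Twisted D from ((u.1, 0) : V₁ × V₂)) +
          (show Twisted D from ((0, u.2) : V₁ × V₂)) :=
        Prod.ext (add_zero u.1).symm (zero_add u.2).symm
      have h4 : f u = f ((u.1, 0) : V₁ × V₂) + f ((0, u.2) : V₁ × V₂) :=
        (congrArg f hu).trans (map_add f.toLinearEquiv _ _)
      rw [h4, e₁]
      rfl
    refine ⟨h, ?_⟩
    ext l v
    let x : Twisted D := ((v, 0) : V₁ × V₂)
    have h5 : f ⁅l, x⁆ = ⁅l, f x⁆ := f.toLieModuleHom.map_lie l x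
    have h6 := (e₃ ⁅l, x⁆).symm.trans (congrArg Prod.snd h5)
    have h7 : h ⁅l, v⁆ + (D l v + ⁅l, (0 : V₂)⁆) = D' l v + ⁅l, h v⁆ :=
      h6.trans (congrArg₂ (fun p q => D' l p + ⁅l, q⁆) (show (f x).1 = v from e₂ x)
        (show (f x).2 = h v from hh v))
    rw [lie_zero, add_zero] at h7
    change ⁅l, h v⁆ - h ⁅l, v⁆ = D l v - D' l v
    rw [sub_eq_sub_iff_add_eq_add, add_comm, ← h7, add_comm]
  · rintro ⟨h, hh⟩
    have key : ∀ l v, h ⁅l, v⁆ + D l v = D' l v + ⁅l, h v⁆ := by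
      intro l v
      have h1 : ⁅l, h v⁆ - h ⁅l, v⁆ = D l v - D' l v :=
        congrArg (fun E : LieDerivation k L (V₁ →ₗ[k] V₂) => E l v) hh
      rw [sub_eq_sub_iff_add_eq_add] at h1
      rw [add_comm, ← h1, add_comm]
    let e : (V₁ × V₂) ≃ₗ[k] (V₁ × V₂) :=
      { toFun := fun u => (u.1, h u.1 + u.2)
        invFun := fun u => (u.1, u.2 - h u.1)
        map_add' := fun u v => Prod.ext rfl (by
          simp only [Prod.fst_add, Prod.snd_add, map_add]; abel)
        map_smul' := fun c u => Prod.ext rfl (by simp)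
        left_inv := fun u => Prod.ext rfl (by simp)
        right_inv := fun u => Prod.ext rfl (by simp) }
    refine ⟨{ (show Twisted D ≃ₗ[k] Twisted D' from e) with map_lie' := ?_ }, ?_, ?_⟩
    · intro l u
      refine Prod.ext rfl ?_
      change h ⁅l, u.1⁆ + (D l u.1 + ⁅l, u.2⁆) = D' l u.1 + ⁅l, h u.1 + u.2⁆
      rw [lie_add, ← add_assoc, key, add_assoc]
    · intro v
      refine Prod.ext rfl ?_
      change h 0 + v = v
      rw [map_zero, zero_add]
    · intro u
      rfl

theorem exists_extOfDer_equivalent (E : ModExt k L V₁ V₂) :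
    ∃ D : LieDerivation k L (V₁ →ₗ[k] V₂), (extOfDer D).Equivalent E := by
  obtain ⟨t, ht⟩ := (E.p : E.U →ₗ[k] V₁).exists_rightInverse_of_surjective
    (LinearMap.range_eq_top.2 E.surj)
  obtain ⟨r, hr⟩ := (E.i : V₂ →ₗ[k] E.U).exists_leftInverse_of_injective
    (LinearMap.ker_eq_bot.2 E.inj)
  have ht' : ∀ v, E.p (t v) = v := fun v => congrArg (fun f : V₁ →ₗ[k] V₁ => f v) ht
  have hr' : ∀ v, r (E.i v) = v := fun v => congrArg (fun f : V₂ →ₗ[k] V₂ => f v) hr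
  have hir : ∀ u, E.p u = 0 → E.i (r u) = u := by
    intro u hu
    obtain ⟨v, rfl⟩ := (E.exact u).1 hu
    rw [hr']
  have hpi : ∀ v, E.p (E.i v) = 0 := fun v => (E.exact _).2 ⟨v, rfl⟩
  let d : L →ₗ[k] V₁ →ₗ[k] V₂ :=
    { toFun := fun l => r ∘ₗ (LieModule.toEnd k L E.U l ∘ₗ t - t ∘ₗ LieModule.toEnd k L V₁ l)
      map_add' := fun a b => by
        ext v
        simp only [LinearMap.comp_apply, LinearMap.sub_apply, LinearMap.add_apply, map_add,
          map_sub]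
        abel
      map_smul' := fun c a => by
        ext v
        simp [smul_sub] }
  have hd : ∀ l v, E.i (d l v) = ⁅l, t v⁆ - t ⁅l, v⁆ := by
    intro l v
    refine hir _ ?_
    change E.p (⁅l, t v⁆ - t ⁅l, v⁆) = 0
    rw [map_sub, LieModuleHom.map_lie, ht', ht', sub_self]
  let D : LieDerivation k L (V₁ →ₗ[k] V₂) :=
    { d with
      leibniz' := fun a b => by
        ext v
        apply E.inj
        change E.i (d ⁅a, b⁆ v) = E.i ((⁅a, d b v⁆ - d b ⁅a, v⁆) - (⁅b, d a v⁆ - d a ⁅b, v⁆))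
        simp only [map_sub, LieModuleHom.map_lie, hd, lie_sub, lie_lie]
        abel }
  have hD : ∀ l v, E.i (D l v) = ⁅l, t v⁆ - t ⁅l, v⁆ := hd
  let e : (V₁ × V₂) ≃ₗ[k] E.U :=
    { toFun := fun u => t u.1 + E.i u.2
      invFun := fun u => (E.p u, r (u - t (E.p u)))
      map_add' := fun u v => by simp only [Prod.fst_add, Prod.snd_add, map_add]; abel
      map_smul' := fun c u => by simp
      left_inv := fun u => by
        refine Prod.ext ?_ ?_
        · simp only [map_add, ht', hpi, add_zero]
        · simp only [map_add, ht', hpi, add_zero, add_sub_cancel_left, hr']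
      right_inv := fun u => by
        simp only
        rw [hir _ (by rw [map_sub, ht', sub_self])]
        abel }
  refine ⟨D, { (show Twisted D ≃ₗ[k] E.U from e) with map_lie' := ?_ }, ?_, ?_⟩
  · intro l u
    change t ⁅l, u.1⁆ + E.i (D l u.1 + ⁅l, u.2⁆) = ⁅l, t u.1 + E.i u.2⁆
    rw [map_add, hD, lie_add, LieModuleHom.map_lie]
    abel
  · intro v
    change t 0 + E.i v = E.i v
    rw [map_zero, zero_add]
  · intro u
    change E.p (t u.1 + E.i u.2) = u.1
    rw [map_add, ht', hpi, add_zero]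

variable (k L V₁ V₂)

/-- The canonical map `H¹(L, Hom(V₁, V₂)) → Ext¹_L(V₁, V₂)`. -/
def h1ToExt1 : H1 k L (V₁ →ₗ[k] V₂) → Ext1 k L V₁ V₂ :=
  Quotient.lift (fun D => Quotient.mk _ (extOfDer D)) fun D D' h =>
    Quotient.sound ((extOfDer_equivalent_iff D D').2 ((Submodule.quotientRel_def _).1 h))

theorem h1ToExt1_bijective : Function.Bijective (h1ToExt1 k L V₁ V₂) := by
  constructor
  · rintro ⟨D⟩ ⟨D'⟩ h
    exact Quotient.sound
      ((Submodule.quotientRel_def _).2 ((extOfDer_equivalent_iff D D').1 (Quotient.exact h)))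
  · rintro ⟨E⟩
    obtain ⟨D, hD⟩ := exists_extOfDer_equivalent E
    exact ⟨Submodule.Quotient.mk D, Quotient.sound hD⟩

/-- The canonical bijection between classes of extensions and `H¹(L, Hom(V₁, V₂))`. -/
def ext1Equiv : Ext1 k L V₁ V₂ ≃ H1 k L (V₁ →ₗ[k] V₂) :=
  (Equiv.ofBijective _ (h1ToExt1_bijective k L V₁ V₂)).symm

/-- The vector space structure of `Ext¹` (the sum is the Baer sum): the sum, respectively a scalar
multiple, of the classes of extensions given by derivations is the class given by the sum,
respectively the scalar multiple, of the derivations. -/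
instance : AddCommGroup (Ext1 k L V₁ V₂) := (ext1Equiv k L V₁ V₂).addCommGroup

instance : Module k (Ext1 k L V₁ V₂) := (ext1Equiv k L V₁ V₂).module k

end Ext

/-! ### Tensor products of finitely many modules of a Lie algebra -/

section Tensor

variable {k : Type u} {L : Type v} [Field k] [LieRing L] [LieAlgebra k L]
variable {ι : Type w₁} (V : ι → Type w₂) [∀ i, AddCommGroup (V i)]
  [∀ i, Module k (V i)] [∀ i, LieRingModule L (V i)] [∀ i, LieModule k L (V i)]

open scoped Classical in
/-- The action of `l` on the `i`-th tensor factor only. -/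
def factorAct (i : ι) (l : L) : Module.End k (⨂[k] i, V i) :=
  PiTensorProduct.map (Function.update (fun _ => LinearMap.id) i (LieModule.toEnd k L (V i) l))

/-- The action of `l` on a tensor product: the sum of its actions on the factors. -/
def tensorAct [Fintype ι] (l : L) : Module.End k (⨂[k] i, V i) := ∑ i, factorAct V i l

theorem factorAct_add (i : ι) (a b : L) :
    factorAct (k := k) V i (a + b) = factorAct V i a + factorAct V i b := by
  classical
  unfold factorAct
  rw [map_add]
  convert PiTensorProduct.map_update_add (R := k) (s := V) (t := V) (fun _ => LinearMap.id) i _ _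

theorem factorAct_smul (i : ι) (c : k) (a : L) :
    factorAct (k := k) V i (c • a) = c • factorAct V i a := by
  classical
  unfold factorAct
  rw [map_smul]
  convert PiTensorProduct.map_update_smul (R := k) (s := V) (t := V) (fun _ => LinearMap.id) i _ _

theorem factorAct_lie (i : ι) (a b : L) :
    factorAct (k := k) V i ⁅a, b⁆ =
      factorAct V i a * factorAct V i b - factorAct V i b * factorAct V i a := by
  classical
  unfold factorAct
  have h := fun x y : L => PiTensorProduct.map_mul (R := k)
    (Function.update (fun j => (LinearMap.id : V j →ₗ[k] V j)) i (LieModule.toEnd k L (V i) x))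
    (Function.update (fun j => (LinearMap.id : V j →ₗ[k] V j)) i (LieModule.toEnd k L (V i) y))
  have h' : ∀ x y : L, (fun j => Function.update (fun j => (LinearMap.id : V j →ₗ[k] V j)) i
      (LieModule.toEnd k L (V i) x) j * Function.update
        (fun j => (LinearMap.id : V j →ₗ[k] V j)) i (LieModule.toEnd k L (V i) y) j) =
      Function.update (fun j => (LinearMap.id : V j →ₗ[k] V j)) i
        (LieModule.toEnd k L (V i) x * LieModule.toEnd k L (V i) y) := by
    intro x y
    funext j
    by_cases hj : j = i
    · subst hj
      simp
    · simp only [Function.update_of_ne hj]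
      rfl
  have hb : LieModule.toEnd k L (V i) ⁅a, b⁆ =
      LieModule.toEnd k L (V i) a * LieModule.toEnd k L (V i) b +
        (-1 : k) • (LieModule.toEnd k L (V i) b * LieModule.toEnd k L (V i) a) := by
    ext v
    simp [sub_eq_add_neg]
  rw [hb]
  rw [PiTensorProduct.map_update_add, PiTensorProduct.map_update_smul, ← h' a b, ← h' b a, h, h]
  rw [sub_eq_add_neg]
  congr 1

theorem factorAct_comm {i j : ι} (h : i ≠ j) (a b : L) :
    factorAct (k := k) V i a * factorAct V j b = factorAct V j b * factorAct V i a := by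
  classical
  unfold factorAct
  rw [← PiTensorProduct.map_mul, ← PiTensorProduct.map_mul]
  congr 1
  funext m
  by_cases hi : m = i
  · subst hi
    rw [Function.update_of_ne h]
    rfl
  · rw [Function.update_of_ne hi]
    rfl

theorem tensorAct_lie [Fintype ι] (a b : L) :
    tensorAct (k := k) V ⁅a, b⁆ =
      tensorAct V a * tensorAct V b - tensorAct V b * tensorAct V a := by
  classical
  unfold tensorAct
  rw [Finset.sum_mul_sum, Finset.sum_mul_sum, Finset.sum_comm (s := Finset.univ)
    (f := fun i j => factorAct V i b * factorAct V j a), ← Finset.sum_sub_distrib]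
  refine Finset.sum_congr rfl fun i _ => ?_
  rw [← Finset.sum_sub_distrib, Finset.sum_eq_single i, factorAct_lie]
  · intro j _ hj
    rw [factorAct_comm V hj.symm, sub_self]
  · intro hi
    exact absurd (Finset.mem_univ i) hi

/-- The tensor product of finitely many `L`-modules is an `L`-module through
`l • (⨂ v_i) = ∑_j v_1 ⊗ ⋯ ⊗ (l • v_j) ⊗ ⋯ ⊗ v_n`. -/
instance [Fintype ι] : LieRingModule L (⨂[k] i, V i) where
  bracket l t := tensorAct V l t
  add_lie a b t := by
    simp only [tensorAct, factorAct_add, Finset.sum_add_distrib, LinearMap.add_apply]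
  lie_add a s t := map_add _ s t
  leibniz_lie a b t := by
    rw [tensorAct_lie]
    simp

instance [Fintype ι] : LieModule k L (⨂[k] i, V i) where
  smul_lie c a t := by
    change tensorAct V (c • a) t = c • tensorAct V a t
    simp only [tensorAct, factorAct_smul, ← Finset.smul_sum, LinearMap.smul_apply]
  lie_smul c a t := map_smul (tensorAct V a) c t

open scoped Classical in
theorem lie_tprod [Fintype ι] (l : L) (v : ∀ i, V i) :
    ⁅l, PiTensorProduct.tprod k v⁆ =
      ∑ i, PiTensorProduct.tprod k (Function.update v i ⁅l, v i⁆) := by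
  change tensorAct V l (PiTensorProduct.tprod k v) = _
  rw [tensorAct, LinearMap.sum_apply]
  refine Finset.sum_congr rfl fun i _ => ?_
  rw [factorAct, PiTensorProduct.map_tprod]
  congr 1
  funext j
  by_cases hj : j = i
  · subst hj
    simp
  · simp [Function.update_of_ne hj]

end Tensor

/-! ### Isomorphism classes of irreducible finite-dimensional modules -/

section Irrep

variable (k : Type u) (L : Type v) [Field k] [LieRing L] [LieAlgebra k L]

/-- A finite-dimensional irreducible module of the Lie `k`-algebra `L`. -/
structure Irrep where
  carrier : Type u
  [acg : AddCommGroup carrier]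
  [mod : Module k carrier]
  [lrm : LieRingModule L carrier]
  [lm : LieModule k L carrier]
  [fin : FiniteDimensional k carrier]
  [irr : LieModule.IsIrreducible k L carrier]

attribute [instance] Irrep.acg Irrep.mod Irrep.lrm Irrep.lm Irrep.fin Irrep.irr

/-- Isomorphism of irreducible modules. -/
instance Irrep.setoid : Setoid (Irrep k L) where
  r := fun ρ σ => Nonempty (ρ.carrier ≃ₗ⁅k,L⁆ σ.carrier)
  iseqv :=
    { refl := fun _ => ⟨LieModuleEquiv.refl⟩
      symm := fun ⟨f⟩ => ⟨f.symm⟩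
      trans := fun ⟨f⟩ ⟨g⟩ => ⟨f.trans g⟩ }

/-- The set of isomorphism classes of irreducible finite-dimensional modules of `L`. -/
def IrrepClass : Type _ := Quotient (Irrep.setoid k L)

/-- The one-dimensional trivial module. -/
def Irrep.trivial : Irrep k L :=
  letI : LieRingModule L k :=
    { bracket := fun _ _ => 0
      add_lie := by simp
      lie_add := by simp
      leibniz_lie := by simp }
  haveI : LieModule k L k :=
    { smul_lie := fun t _ _ => (smul_zero t).symm
      lie_smul := fun t _ _ => (smul_zero t).symm }
  { carrier := k
    irr := LieModule.IsIrreducible.mk fun N hN => by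
      rw [← LieSubmodule.toSubmodule_eq_top]
      refine (eq_bot_or_eq_top (N : Submodule k k)).resolve_left fun h => hN ?_
      rwa [LieSubmodule.toSubmodule_eq_bot] at h }

/-- The isomorphism class of the one-dimensional trivial module. -/
def IrrepClass.trivial : IrrepClass k L := Quotient.mk _ (Irrep.trivial k L)

variable {k L}

/-- The pullback of an irreducible module along a surjective homomorphism `f : L' → L`. -/
def Irrep.comap {L' : Type w} [LieRing L'] [LieAlgebra k L'] (f : L' →ₗ⁅k⁆ L)
    (hf : Function.Surjective f) (ρ : Irrep k L) : Irrep k L' :=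
  letI : LieRingModule L' ρ.carrier := LieRingModule.compLieHom ρ.carrier f
  haveI : LieModule k L' ρ.carrier := LieModule.compLieHom ρ.carrier f
  { carrier := ρ.carrier
    irr := by
      have : Nontrivial ρ.carrier := (LieSubmodule.nontrivial_iff k L ρ.carrier).1 inferInstance
      refine LieModule.IsIrreducible.mk fun N hN => ?_
      let N' : LieSubmodule k L ρ.carrier :=
        { (N : Submodule k ρ.carrier) with
          lie_mem := fun {x m} hm => by
            obtain ⟨y, rfl⟩ := hf x
            exact N.lie_mem (x := y) hm }
      have h : N' = ⊥ ∨ N' = ⊤ := eq_bot_or_eq_top N'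
      have e : (N' : Submodule k ρ.carrier) = N := rfl
      rw [← LieSubmodule.toSubmodule_eq_top, ← e, LieSubmodule.toSubmodule_eq_top]
      refine h.resolve_left fun h0 => hN ?_
      rw [← LieSubmodule.toSubmodule_eq_bot, ← e, h0, LieSubmodule.bot_toSubmodule] }

/-- The pullback of an isomorphism class along a surjective homomorphism `f : L' → L`. -/
def IrrepClass.comap {L' : Type w} [LieRing L'] [LieAlgebra k L'] (f : L' →ₗ⁅k⁆ L)
    (hf : Function.Surjective f) : IrrepClass k L → IrrepClass k L' :=
  Quotient.map (Irrep.comap f hf) fun _ _ ⟨e⟩ =>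
    ⟨{ e.toLinearEquiv with map_lie' := fun {x m} => e.toLieModuleHom.map_lie (f x) m }⟩

end Irrep

/-! ### Equivariant map algebras -/

/-- A group acting on a Lie ring compatibly with the bracket. -/
class LieAutAction (Γ : Type v) (g : Type w) [Group Γ] [LieRing g] [DistribMulAction Γ g] :
    Prop where
  smul_lie (γ : Γ) (x y : g) : γ • ⁅x, y⁆ = ⁅γ • x, γ • y⁆

/-- The rational points of `X = Spec A`, as `k`-algebra homomorphisms `A → k`. -/
def RatPoint (k : Type u) (A : Type v) [Field k] [CommRing A] [Algebra k A] : Type (max u v) :=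
  A →ₐ[k] k

/-- A rational point as a homomorphism; `x.toAlgHom f` is the value `f(x)` of `f ∈ A` at `x`. -/
def RatPoint.toAlgHom {k : Type u} {A : Type v} [Field k] [CommRing A] [Algebra k A]
    (x : RatPoint k A) : A →ₐ[k] k := x

section Algebra

variable (k : Type*) (A : Type*) (g : Type*) (Γ : Type*) [Field k]
  [CommRing A] [Algebra k A] [LieRing g] [LieAlgebra k g] [Group Γ]
  [MulSemiringAction Γ A] [SMulCommClass Γ k A]
  [DistribMulAction Γ g] [SMulCommClass Γ k g] [LieAutAction Γ g]

variable {k A Γ} in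
/-- The action of `Γ` on the rational points: `f (γ • x) = (γ⁻¹ • f) x` for `f ∈ A`. -/
instance : MulAction Γ (RatPoint k A) where
  smul γ x := AlgHom.comp x.toAlgHom (MulSemiringAction.toAlgHom k A γ⁻¹)
  one_smul x := by
    refine AlgHom.ext fun a => ?_
    change x.toAlgHom ((1 : Γ)⁻¹ • a) = x.toAlgHom a
    rw [inv_one, one_smul]
  mul_smul γ δ x := by
    refine AlgHom.ext fun a => ?_
    change x.toAlgHom ((γ * δ)⁻¹ • a) = x.toAlgHom (δ⁻¹ • γ⁻¹ • a)
    rw [mul_inv_rev, mul_smul]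

variable {Γ} in
/-- An element of `Γ` acting on `g` as a homomorphism of Lie algebras. -/
def actHom (γ : Γ) : g →ₗ⁅k⁆ g :=
  { DistribSMul.toLinearMap k g γ with
    map_lie' := fun {x y} => LieAutAction.smul_lie γ x y }

variable {Γ} in
/-- The diagonal action of `γ ∈ Γ` on the Lie algebra `A ⊗ g` of regular maps `X → g`. -/
def diagHom (γ : Γ) : A ⊗[k] g →ₗ⁅k⁆ A ⊗[k] g :=
  LieAlgebra.ExtendScalars.map (MulSemiringAction.toAlgHom k A γ) (actHom k g γ)

/-- The equivariant map algebra `M(X, g)^Γ`: the fixed points of the diagonal action of `Γ` on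
`A ⊗ g`, where `X = Spec A`. -/
def mapAlgebra : LieSubalgebra k (A ⊗[k] g) where
  carrier := {α | ∀ γ : Γ, diagHom k A g γ α = α}
  add_mem' := fun {α β} hα hβ γ => by rw [map_add, hα γ, hβ γ]
  zero_mem' := fun γ => map_zero _
  smul_mem' := fun c α hα γ => by rw [map_smul, hα γ]
  lie_mem' := fun {α β} hα hβ γ => by rw [LieHom.map_lie, hα γ, hβ γ]

variable {A} in
/-- The subalgebra `g^x` of `g` fixed by the isotropy group of the point `x`. -/
def isotropy (x : RatPoint k A) : LieSubalgebra k g where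
  carrier := {u | ∀ γ ∈ MulAction.stabilizer Γ x, γ • u = u}
  add_mem' := fun {u v} hu hv γ hγ => by rw [smul_add, hu γ hγ, hv γ hγ]
  zero_mem' := fun γ _ => smul_zero γ
  smul_mem' := fun c u hu γ hγ => by rw [smul_comm, hu γ hγ]
  lie_mem' := fun {u v} hu hv γ hγ => by rw [LieAutAction.smul_lie, hu γ hγ, hv γ hγ]

variable {A} in
/-- Evaluation of a regular map `α ∈ A ⊗ g` at a rational point: `f ⊗ u ↦ f(x) u`. -/
def evalLin (x : RatPoint k A) : A ⊗[k] g →ₗ[k] g :=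
  (TensorProduct.lid k g).toLinearMap ∘ₗ
    TensorProduct.map (AlgHom.toLinearMap x.toAlgHom) LinearMap.id

variable {A} in
theorem evalLin_tmul (x : RatPoint k A) (a : A) (u : g) :
    evalLin k g x (a ⊗ₜ u) = x.toAlgHom a • u := rfl

variable {A} in
theorem evalLin_lie (x : RatPoint k A) (α β : A ⊗[k] g) :
    evalLin k g x ⁅α, β⁆ = ⁅evalLin k g x α, evalLin k g x β⁆ := by
  induction α with
  | zero => rw [zero_lie, map_zero, zero_lie]
  | add α₁ α₂ h₁ h₂ => rw [add_lie, map_add, h₁, h₂, map_add, add_lie]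
  | tmul a u =>
    induction β with
    | zero => rw [lie_zero, map_zero, lie_zero]
    | add β₁ β₂ h₁ h₂ => rw [lie_add, map_add, h₁, h₂, map_add, lie_add]
    | tmul b v =>
      rw [LieAlgebra.ExtendScalars.bracket_tmul, evalLin_tmul, evalLin_tmul, evalLin_tmul,
        map_mul, smul_lie, lie_smul, smul_smul]

variable {A Γ} in
theorem evalLin_smul (x : RatPoint k A) (γ : Γ) (α : A ⊗[k] g) :
    evalLin k g (γ • x) (diagHom k A g γ α) = γ • evalLin k g x α := by
  induction α with
  | zero => rw [map_zero, map_zero, map_zero, smul_zero]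
  | add α₁ α₂ h₁ h₂ => rw [map_add, map_add, h₁, h₂, map_add, smul_add]
  | tmul a u =>
    change x.toAlgHom (γ⁻¹ • γ • a) • γ • u =
      γ • (x.toAlgHom a • u)
    rw [inv_smul_smul, smul_comm γ]

variable {A} in
/-- Evaluation `M(X, g)^Γ → g^x` at the rational point `x`. -/
def evalHom (x : RatPoint k A) : mapAlgebra k A g Γ →ₗ⁅k⁆ isotropy k g Γ x where
  toFun α := ⟨evalLin k g x α, fun γ hγ => by
    have h := evalLin_smul k g x γ (α : A ⊗[k] g)
    rw [α.2 γ, MulAction.mem_stabilizer_iff.1 hγ] at h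
    exact h.symm⟩
  map_add' α β := Subtype.ext (map_add (evalLin k g x) (α : A ⊗[k] g) β)
  map_smul' c α := Subtype.ext (map_smul (evalLin k g x) c (α : A ⊗[k] g))
  map_lie' := fun {α β} => Subtype.ext (evalLin_lie k g x α β)

variable {A Γ} in
/-- The isomorphism `g^{γ x} → g^x`, `u ↦ γ⁻¹ u`. -/
def isotropyConj (γ : Γ) (x : RatPoint k A) :
    isotropy k g Γ (γ • x) →ₗ⁅k⁆ isotropy k g Γ x where
  toFun u := ⟨γ⁻¹ • (u : g), fun δ hδ => by
    have h : γ * δ * γ⁻¹ ∈ MulAction.stabilizer Γ (γ • x) := by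
      rw [MulAction.mem_stabilizer_iff, mul_smul, mul_smul, inv_smul_smul,
        MulAction.mem_stabilizer_iff.1 hδ]
    have h' := u.2 _ h
    rw [mul_smul, mul_smul] at h'
    rw [eq_inv_smul_iff]
    exact h'⟩
  map_add' u v := Subtype.ext (smul_add γ⁻¹ (u : g) v)
  map_smul' c u := Subtype.ext (smul_comm γ⁻¹ c (u : g))
  map_lie' := fun {u v} => Subtype.ext (LieAutAction.smul_lie γ⁻¹ (u : g) v)

variable {A Γ} in
theorem isotropyConj_surjective (γ : Γ) (x : RatPoint k A) :
    Function.Surjective (isotropyConj k g γ x) := by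
  intro u
  refine ⟨⟨γ • (u : g), fun δ hδ => ?_⟩, Subtype.ext (inv_smul_smul γ (u : g))⟩
  have h : γ⁻¹ * δ * γ ∈ MulAction.stabilizer Γ x := by
    rw [MulAction.mem_stabilizer_iff, mul_smul, mul_smul, MulAction.mem_stabilizer_iff.1 hδ,
      inv_smul_smul]
  have h' := u.2 _ h
  rwa [mul_smul, mul_smul, inv_smul_eq_iff] at h'

/-! ### Evaluation modules -/

variable {k A} in
/-- The evaluation module at `x` attached to a `g^x`-module `W`: the space `W`, on which
`α ∈ M(X, g)^Γ` acts as `α(x) ∈ g^x`. -/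
def EvalAt (_x : RatPoint k A) (W : Type w) : Type w := W

section EvalAt

variable (x : RatPoint k A) (W : Type*) [AddCommGroup W] [Module k W]
  [LieRingModule (isotropy k g Γ x) W] [LieModule k (isotropy k g Γ x) W]

instance : AddCommGroup (EvalAt x W) := inferInstanceAs (AddCommGroup W)
instance : Module k (EvalAt x W) := inferInstanceAs (Module k W)

instance : LieRingModule (mapAlgebra k A g Γ) (EvalAt x W) :=
  LieRingModule.compLieHom W (evalHom k g Γ x)

instance : LieModule k (mapAlgebra k A g Γ) (EvalAt x W) :=
  LieModule.compLieHom W (evalHom k g Γ x)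

end EvalAt

variable {k A} in
/-- The members of `X_*`: finite sets of rational points, no two distinct elements of which have
intersecting `Γ`-orbits. -/
def IsTransversal (s : Finset (RatPoint k A)) : Prop :=
  ∀ x ∈ s, ∀ y ∈ s, x ≠ y → Disjoint (MulAction.orbit Γ x) (MulAction.orbit Γ y)

variable {k A} in
/-- The underlying space of the evaluation representation at a finite set `s` of points attached to
`g^x`-modules `V x`, `x ∈ s`: the tensor product of the evaluation modules at the points. -/
abbrev EvalTensor (s : Finset (RatPoint k A)) (V : s → Type w) [∀ x, AddCommGroup (V x)]
    [∀ x, Module k (V x)] : Type _ :=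
  ⨂[k] x : s, EvalAt x.1 (V x)

/-- The finitely supported `Γ`-equivariant functions `ψ` on the rational points, with `ψ(x)` an
isomorphism class of irreducible finite-dimensional `g^x`-modules. -/
structure EvalParam where
  toFun : ∀ x : RatPoint k A, IrrepClass k (isotropy k g Γ x)
  equivariant : ∀ (γ : Γ) (x : RatPoint k A), toFun (γ • x) =
    (toFun x).comap (isotropyConj k g γ x) (isotropyConj_surjective k g γ x)
  finite_support : {x | toFun x ≠ IrrepClass.trivial k (isotropy k g Γ x)}.Finite

namespace EvalParam

variable {k A g Γ}

/-- The support of `ψ`. -/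
def support (ψ : EvalParam k A g Γ) : Set (RatPoint k A) :=
  {x | ψ.toFun x ≠ IrrepClass.trivial k (isotropy k g Γ x)}

/-- `V` belongs to the isomorphism class `ev_ψ`: for a set `s` which contains exactly one element of
each `Γ`-orbit in the support of `ψ`, and irreducible modules `σ x` in the class `ψ(x)`, `x ∈ s`,
`V` is isomorphic to the evaluation representation attached to the `σ x`. -/
def Corresponds (ψ : EvalParam k A g Γ) (V : Type w) [AddCommGroup V] [Module k V]
    [LieRingModule (mapAlgebra k A g Γ) V] [LieModule k (mapAlgebra k A g Γ) V] : Prop :=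
  ∃ (s : Finset (RatPoint k A)) (σ : ∀ x : s, Irrep k (isotropy k g Γ x.1)),
    IsTransversal Γ s ∧ (∀ x ∈ s, x ∈ ψ.support) ∧
    (∀ x ∈ ψ.support, ∃ y ∈ s, y ∈ MulAction.orbit Γ x) ∧
    (∀ x : s, ψ.toFun x.1 = Quotient.mk _ (σ x)) ∧
    Nonempty (V ≃ₗ⁅k, mapAlgebra k A g Γ⁆ EvalTensor s fun x => (σ x).carrier)

/-- The set of points at which `ψ` and `ψ'` differ. -/
def diffSet (ψ ψ' : EvalParam k A g Γ) : Set (RatPoint k A) := {x | ψ.toFun x ≠ ψ'.toFun x}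

end EvalParam

end Algebra

/-- The abelianization `L / [L, L]` of a Lie algebra. -/
abbrev Abelianization (k : Type u) (L : Type v) [Field k] [LieRing L] [LieAlgebra k L] : Type v :=
  L ⧸ (⁅(⊤ : LieIdeal k L), (⊤ : LieIdeal k L)⁆ : LieIdeal k L)

end EMA

end

/-!
For modules `U`, `W` of a Lie algebra `L`, `Ext¹(U, W)` is `H¹(L, Hom(U, W))`, and for
`V = ⨂ V x`, `V' = ⨂ V' x` there is an isomorphism of `L`-modules `Hom(V, V') ≃ ⨂ M x` with
`M x = Hom(V x, V' x)` (`tensorHomEquiv`). So the statement is about `H¹` of a tensor product of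
modules, the `x`-th of which sees only the value of a map at the point `x`.

Since the points lie on different orbits, there are `Γ`-invariant functions `a x ∈ A` with value `1`
at `x` and `0` at the other points. Multiplication by `a x` is an element `T x` of the centroid of
`L` which acts like the identity as far as `M x` is concerned, and kills the other factors
(`IsSeparating`). This alone gives the main vanishing result, `exists_inner_of_two_factors`: let `P`
be an idempotent of `⨂ M x` which commutes with `L` and which, for two different factors, lies in
the left ideal generated by the operators of `L` on this factor. Then `P ∘ D` is inner for every
derivation `D`. Indeed, on the elements which act by zero, `P ∘ D` vanishes by an argument with
`T`; then the cocycle identity for elements that act on one factor each expresses `P ∘ D` as the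
bracket with an explicit vector.

By Schur's lemma, `M x` has no invariants if `V x` and `V' x` are not isomorphic, and otherwise its
invariants are spanned by an isomorphism `u`, with invariant complement the kernel of the
normalised trace form (`isSplitUnit_of_equiv`); no complete reducibility is needed. In both cases
the projection `p x` of `M x` along its invariants lies in the left ideal generated by `L`
(`exists_sum_mul_toEnd`). Expanding `id = ⨂ (p x + q x)`, all terms with two factors `p` act by zero
on `H¹` (`IsSeparating.eq_add_sum`), and the three parts of the theorem can be read off:
`IsSeparating.subsingleton_H1`, `IsSeparating.nonempty_H1_equiv_factor` and
`IsSeparating.nonempty_prod_H1_equiv`, where the summand `M_ab^*` is `H¹` of the invariants.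

It remains to see that `ψ x` is the class of `V x` for `x ∈ s` and trivial off the orbits of `s`
(`EvalParam.Corresponds.nonempty_equiv`, `EvalParam.Corresponds.eq_trivial`). For this the two
tensor products are compared as modules over the maps `a α`, with `a` an invariant function that
vanishes at all points involved off the orbit of `x`: these act on the factor at `x` only.
Surjectivity of the evaluation `M(X, g)^Γ → g^x` (averaging over `Γ`) turns isomorphisms of
evaluation modules into isomorphisms of `g^x`-modules.
-/

open scoped TensorProduct

noncomputable section

namespace EMA

/-! ### Derivations into a module with two commuting actions -/

section TwoFactors

variable {k : Type*} {L : Type*} {W : Type*} [Field k] [LieRing L] [LieAlgebra k L]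
  [AddCommGroup W] [Module k W] [LieRingModule L W] [LieModule k L W]

theorem apply_eq_zero_of_sum_mul {σ : Type*} {P : Module.End k W} (s : Finset σ)
    {r a : σ → Module.End k W} (hP : P = ∑ j ∈ s, r j * a j) {w : W}
    (h : ∀ j, a j w = 0) : P w = 0 := by
  rw [hP, LinearMap.sum_apply]
  exact Finset.sum_eq_zero fun j _ => by rw [Module.End.mul_apply, h, map_zero]

/-- Let `L` act on `W` by the sum of two commuting actions `ρ₁`, `ρ₂`, told apart by an element `T`
of the centroid of `L`, and let `P` be an idempotent which commutes with both actions and lies in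
the left ideal generated by either, with coefficients which commute with the other action. Then the
composition of any derivation `L → W` with `P` is inner. -/
theorem exists_inner_of_two_factors {ρ₁ ρ₂ : L →ₗ[k] Module.End k W}
    (hρ : ∀ (a : L) (w : W), ⁅a, w⁆ = ρ₁ a w + ρ₂ a w)
    (hρc : ∀ a b, Commute (ρ₁ a) (ρ₂ b))
    {T : L →ₗ[k] L} (hT : ∀ a b, T ⁅a, b⁆ = ⁅T a, b⁆)
    (hT₁ : ∀ a, ρ₁ (T a) = ρ₁ a) (hT₂ : ∀ a, ρ₂ (T a) = 0)
    {P : Module.End k W} (hPP : P * P = P)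
    (hP₁ : ∀ a, Commute P (ρ₁ a)) (hP₂ : ∀ a, Commute P (ρ₂ a))
    {σ₁ : Type*} (s₁ : Finset σ₁) {r₁ : σ₁ → Module.End k W} {l₁ : σ₁ → L}
    (hr₁ : ∀ j a, Commute (r₁ j) (ρ₂ a)) (hs₁ : P = ∑ j ∈ s₁, r₁ j * ρ₁ (l₁ j))
    {σ₂ : Type*} (s₂ : Finset σ₂) {r₂ : σ₂ → Module.End k W} {l₂ : σ₂ → L}
    (hr₂ : ∀ j a, Commute (r₂ j) (ρ₁ a)) (hs₂ : P = ∑ j ∈ s₂, r₂ j * ρ₂ (l₂ j))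
    (D : LieDerivation k L W) : ∃ w : W, ∀ a, P (D a) = ⁅a, w⁆ := by
  have cm : ∀ {f g : Module.End k W}, Commute f g → ∀ w, f (g w) = g (f w) :=
    fun h w => congrArg (fun e : Module.End k W => e w) h.eq
  have hT' : ∀ a b, T ⁅a, b⁆ = ⁅a, T b⁆ := fun a b => by
    rw [← lie_skew, map_neg, hT, lie_skew]
  have PP : ∀ w, P (P w) = P w := fun w => congrArg (fun e : Module.End k W => e w) hPP
  have hD : ∀ a b, D ⁅a, b⁆ = (ρ₁ a (D b) + ρ₂ a (D b)) - (ρ₁ b (D a) + ρ₂ b (D a)) := fun a b => by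
    rw [LieDerivation.apply_lie_eq_sub, hρ, hρ]
  -- `D` kills brackets of elements of the common kernel `K`; for `c ∈ K` the bracket of `T a` with
  -- `c - T c` is one, by moving `T` to the other side. So `D (c - T c)` is annihilated by `ρ₁`,
  -- likewise `D (T c)` by `ρ₂`, and `P` lies in both left ideals.
  have hK : ∀ c, ρ₁ c = 0 → ρ₂ c = 0 → P (D c) = 0 := by
    intro c h₁ h₂
    have hKK : ∀ a b, ρ₁ a = 0 → ρ₂ a = 0 → ρ₁ b = 0 → ρ₂ b = 0 → D ⁅a, b⁆ = 0 := by
      intro a b h1 h2 h3 h4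
      rw [hD, h1, h2, h3, h4]; simp
    have e₁ : ∀ a, ρ₁ a (D (c - T c)) = 0 := by
      intro a
      have h3 := hD (T a) (c - T c)
      have h4 : ⁅T a, c - T c⁆ = ⁅T a - T (T a), c⁆ := by
        rw [lie_sub, sub_lie, ← hT' (T a) c, ← hT (T a) c]
      rw [h4, hKK _ _ (by rw [map_sub, hT₁, hT₁, hT₁, sub_self])
        (by rw [map_sub, hT₂, hT₂, sub_self]) h₁ h₂] at h3
      simpa [hT₁, hT₂, h₁, h₂] using h3.symm
    have e₂ : ∀ a, ρ₂ a (D (T c)) = 0 := by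
      intro a
      have h3 := hD (a - T a) (T c)
      have h4 : ⁅a - T a, T c⁆ = ⁅T a - T (T a), c⁆ := by
        rw [sub_lie, sub_lie, ← hT' a c, ← hT' (T a) c, hT a c, hT (T a) c]
      rw [h4, hKK _ _ (by rw [map_sub, hT₁, hT₁, hT₁, sub_self])
        (by rw [map_sub, hT₂, hT₂, sub_self]) h₁ h₂] at h3
      simpa [hT₁, hT₂, h₁, h₂] using h3.symm
    have e₃ : D c = D (c - T c) + D (T c) := by rw [← map_add, sub_add_cancel]
    rw [e₃, map_add, apply_eq_zero_of_sum_mul s₁ hs₁ fun j => e₁ _,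
      apply_eq_zero_of_sum_mul s₂ hs₂ fun j => e₂ _, add_zero]
  -- `a - T a` acts through `ρ₂` only and `T b` through `ρ₁` only, so their bracket lies in the
  -- common kernel
  have hmix : ∀ a b, ρ₂ a (P (D (T b))) = ρ₁ b (P (D (a - T a))) := by
    intro a b
    have h1 : ⁅a - T a, T b⁆ = T ⁅a - T a, b⁆ := (hT' _ _).symm
    have h1' : ⁅a - T a, T b⁆ = ⁅a, T b⁆ - T ⁅a, T b⁆ := by rw [sub_lie, hT]
    have h2 : ρ₁ (a - T a) = 0 := by rw [map_sub, hT₁, sub_self]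
    have h3 : ρ₂ (a - T a) = ρ₂ a := by rw [map_sub, hT₂, sub_zero]
    have h4 := hK ⁅a - T a, T b⁆ (by rw [h1', map_sub, hT₁, sub_self]) (by rw [h1, hT₂])
    rw [hD, h2, h3, hT₁, hT₂, LinearMap.zero_apply, LinearMap.zero_apply, zero_add, add_zero,
      map_sub, sub_eq_zero, cm (hP₂ a), cm (hP₁ b)] at h4
    exact h4
  -- apply the two expressions for `P` to `P (D (T b))` and `P (D (a - T a))`, using `hmix`
  let w₁ : W := ∑ j ∈ s₂, r₂ j (P (D (l₂ j - T (l₂ j))))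
  let w₂ : W := ∑ j ∈ s₁, r₁ j (P (D (T (l₁ j))))
  have hw₁ : ∀ b, P (D (T b)) = ρ₁ b w₁ := by
    intro b
    rw [← PP]
    conv_lhs => rw [hs₂]
    rw [LinearMap.sum_apply, map_sum]
    refine Finset.sum_congr rfl fun j _ => ?_
    rw [Module.End.mul_apply, ← hs₂, hmix, cm (hr₂ j b)]
  have hw₂ : ∀ a, P (D (a - T a)) = ρ₂ a w₂ := by
    intro a
    rw [← PP]
    conv_lhs => rw [hs₁]
    rw [LinearMap.sum_apply, map_sum]
    refine Finset.sum_congr rfl fun j _ => ?_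
    rw [Module.End.mul_apply, ← hs₁, ← hmix, cm (hr₁ j a)]
  have hww : P w₁ = P w₂ := by
    rw [← sub_eq_zero, ← map_sub, ← PP]
    have h0 : ∀ a b, ρ₁ b (ρ₂ a (w₁ - w₂)) = 0 := fun a b => by
      have h1 := hmix a b
      rw [hw₁, hw₂, ← cm (hρc b a)] at h1
      rw [map_sub, map_sub, h1, sub_self]
    have h1 : ∀ a, ρ₂ a (P (w₁ - w₂)) = 0 := fun a => by
      rw [← cm (hP₂ a)]
      exact apply_eq_zero_of_sum_mul s₁ hs₁ fun j => h0 a _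
    exact apply_eq_zero_of_sum_mul s₂ hs₂ fun j => h1 _
  refine ⟨P w₁, fun a => ?_⟩
  have h1 : P (D a) = P (D (T a)) + P (D (a - T a)) := by rw [← map_add, ← map_add, add_sub_cancel]
  rw [← PP (D a), h1, hw₁, hw₂, map_add, cm (hP₁ a), cm (hP₂ a), ← hww, hρ]

end TwoFactors

/-! ### Endomorphisms of one tensor factor -/

section FactorEnd

variable {k : Type u} [Field k] {ι : Type w₁} {V : ι → Type w₂} [∀ i, AddCommGroup (V i)]
  [∀ i, Module k (V i)]

open scoped Classical in
/-- The endomorphism of `⨂ V j` which applies `f` to the `i`-th tensor factor, as an algebra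
homomorphism in `f`. -/
def factorEnd (i : ι) : Module.End k (V i) →ₐ[k] Module.End k (⨂[k] j, V j) :=
  AlgHom.ofLinearMap
    { toFun := fun f => PiTensorProduct.map (Function.update (fun _ => LinearMap.id) i f)
      map_add' := fun f g => PiTensorProduct.map_update_add (R := k) (s := V) (t := V) _ i f g
      map_smul' := fun c f => PiTensorProduct.map_update_smul (R := k) (s := V) (t := V) _ i c f }
    (by
      change PiTensorProduct.map (Function.update (fun j => (LinearMap.id : V j →ₗ[k] V j)) i
        LinearMap.id) = LinearMap.id
      rw [Function.update_eq_self i (fun j => (LinearMap.id : V j →ₗ[k] V j)),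
        PiTensorProduct.map_id])
    (by
      intro f g
      change PiTensorProduct.map _ = PiTensorProduct.map _ * PiTensorProduct.map _
      rw [← PiTensorProduct.map_mul]
      congr 1
      funext j
      by_cases h : j = i
      · subst h; simp
      · simp only [Function.update_of_ne h]; rfl)

open scoped Classical in
theorem factorEnd_apply (i : ι) (f : Module.End k (V i)) :
    factorEnd i f = PiTensorProduct.map (Function.update (fun _ => LinearMap.id) i f) := rfl

open scoped Classical in
theorem factorEnd_tprod (i : ι) (f : Module.End k (V i)) (v : ∀ j, V j) :
    factorEnd i f (PiTensorProduct.tprod k v) =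
      PiTensorProduct.tprod k (Function.update v i (f (v i))) := by
  rw [factorEnd_apply, PiTensorProduct.map_tprod]
  congr 1
  funext j
  by_cases h : j = i
  · subst h; simp
  · simp [Function.update_of_ne h]

theorem commute_factorEnd_of_ne {i j : ι} (h : i ≠ j) (f : Module.End k (V i))
    (f' : Module.End k (V j)) : Commute (factorEnd i f) (factorEnd (V := V) j f') := by
  classical
  refine PiTensorProduct.ext (MultilinearMap.ext fun v => ?_)
  simp only [LinearMap.compMultilinearMap_apply, Module.End.mul_apply, factorEnd_tprod]
  rw [Function.update_of_ne h, Function.update_of_ne h.symm, Function.update_comm h]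

theorem commute_factorEnd {i j : ι} {f : Module.End k (V i)} {f' : Module.End k (V j)}
    (h : ∀ e : i = j, Commute (e ▸ f) f') : Commute (factorEnd i f) (factorEnd (V := V) j f') := by
  by_cases e : i = j
  · subst e
    exact (h rfl).map (factorEnd i)
  · exact commute_factorEnd_of_ne e f f'

variable {L : Type v} [LieRing L] [LieAlgebra k L] [∀ i, LieRingModule L (V i)]
  [∀ i, LieModule k L (V i)]

theorem lie_eq_sum_factorEnd [Fintype ι] (l : L) (t : ⨂[k] j, V j) :
    ⁅l, t⁆ = ∑ i, factorEnd i (LieModule.toEnd k L (V i) l) t := by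
  change tensorAct V l t = _
  rw [tensorAct, LinearMap.sum_apply]
  rfl

end FactorEnd

/-! ### Centroid elements which separate the tensor factors -/

section Vanishing

variable {k : Type u} {L : Type v} [Field k] [LieRing L] [LieAlgebra k L]

/-- An idempotent of a module which commutes with the action of `L` and lies in the left ideal of
the endomorphism algebra generated by the action. -/
structure IsActionProj {M : Type*} [AddCommGroup M] [Module k M] [LieRingModule L M]
    [LieModule k L M] (p : Module.End k M) : Prop where
  idem : p * p = p
  comm : ∀ l : L, Commute p (LieModule.toEnd k L M l)
  exists_sum : ∃ (s : Finset L) (r : L → Module.End k M),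
    p = ∑ l ∈ s, r l * LieModule.toEnd k L M l

variable {ι : Type w₁} [Fintype ι] {V : ι → Type w₂} [∀ i, AddCommGroup (V i)]
  [∀ i, Module k (V i)] [∀ i, LieRingModule L (V i)] [∀ i, LieModule k L (V i)]

/-- `T a` acts like `a` on the `i`-th module and by zero on the others. -/
structure ActsOnly (k : Type*) {L : Type*} [Field k] [LieRing L] [LieAlgebra k L]
    {ι : Type*} (V : ι → Type*) [∀ i, AddCommGroup (V i)]
    [∀ i, Module k (V i)] [∀ i, LieRingModule L (V i)] [∀ i, LieModule k L (V i)]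
    (T : L → L) (i : ι) : Prop where
  lie_self : ∀ a (v : V i), ⁅T a, v⁆ = ⁅a, v⁆
  lie_of_ne : ∀ j, j ≠ i → ∀ a (v : V j), ⁅T a, v⁆ = 0

/-- A family of elements of the centroid of `L` which separates the modules `V i`: `T i` acts only
on `V i`, as the identity. -/
structure IsSeparating (k : Type*) {L : Type*} [Field k] [LieRing L] [LieAlgebra k L]
    {ι : Type*} (V : ι → Type*) [∀ i, AddCommGroup (V i)]
    [∀ i, Module k (V i)] [∀ i, LieRingModule L (V i)] [∀ i, LieModule k L (V i)]
    (T : ι → L →ₗ[k] L) : Prop where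
  map_lie : ∀ i a b, T i ⁅a, b⁆ = ⁅T i a, b⁆
  actsOnly : ∀ i, ActsOnly k V (T i) i

/-- The composition of a derivation with a projection which is nontrivial on two different tensor
factors is inner. -/
theorem IsSeparating.exists_inner {T : ι → L →ₗ[k] L} (hT : IsSeparating k V T) {i j : ι}
    (hij : i ≠ j) {p : Module.End k (V i)} (hp : IsActionProj (L := L) p)
    {p' : Module.End k (V j)} (hp' : IsActionProj (L := L) p')
    (D : LieDerivation k L (⨂[k] i, V i)) :
    ∃ w, ∀ a, factorEnd i p (factorEnd j p' (D a)) = ⁅a, w⁆ := by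
  classical
  obtain ⟨s, r, hs⟩ := hp.exists_sum
  obtain ⟨s', r', hs'⟩ := hp'.exists_sum
  let ρ : ∀ i, L →ₗ[k] Module.End k (⨂[k] i, V i) := fun i =>
    { toFun := fun a => factorEnd i (LieModule.toEnd k L (V i) a)
      map_add' := fun a b => by rw [map_add, map_add]
      map_smul' := fun c a => by rw [map_smul, map_smul, RingHom.id_apply] }
  have hρ : ∀ i a, ρ i a = factorEnd i (LieModule.toEnd k L (V i) a) := fun _ _ => rfl
  -- the second action is the one on all factors but the `i`-th
  let ρ₂ : L →ₗ[k] Module.End k (⨂[k] i, V i) := ∑ m ∈ Finset.univ.erase i, ρ m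
  have hρ₂ : ∀ a, ρ₂ a = ∑ m ∈ Finset.univ.erase i, ρ m a := fun a => by
    simp only [ρ₂, LinearMap.sum_apply]
  have hself : ∀ i a, ρ i (T i a) = ρ i a := fun i a => by
    rw [hρ, hρ]; congr 1; ext v; exact (hT.actsOnly i).lie_self a v
  have hne : ∀ i m, m ≠ i → ∀ a, ρ m (T i a) = 0 := fun i m hm a => by
    rw [hρ, ← map_zero (factorEnd (k := k) (V := V) m)]; congr 1; ext v
    exact (hT.actsOnly i).lie_of_ne m hm a v
  have hcp : ∀ m a, Commute (factorEnd (V := V) i p) (ρ m a) := fun m a =>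
    commute_factorEnd fun e => by subst e; exact hp.comm a
  have hcp' : ∀ m a, Commute (factorEnd (V := V) j p') (ρ m a) := fun m a =>
    commute_factorEnd fun e => by subst e; exact hp'.comm a
  have hpp : Commute (factorEnd (V := V) i p) (factorEnd j p') := commute_factorEnd_of_ne hij _ _
  have hcr : ∀ l m, m ≠ i → ∀ a, Commute (factorEnd (V := V) i (r l)) (ρ m a) := fun l m hm a =>
    commute_factorEnd_of_ne hm.symm _ _
  -- `ρ₂` agrees with the action on the `j`-th factor at elements of the form `T j l`
  refine exists_inner_of_two_factors (ρ₁ := ρ i) (ρ₂ := ρ₂) (T := T i)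
    (P := factorEnd i p * factorEnd j p') ?_ ?_ (hT.map_lie i) (hself i) ?_ ?_ ?_ ?_
    s (r₁ := fun l => factorEnd j p' * factorEnd i (r l)) (l₁ := id) ?_ ?_
    s' (r₂ := fun l => factorEnd i p * factorEnd j (r' l)) (l₂ := T j) ?_ ?_ D
  · intro a w
    rw [lie_eq_sum_factorEnd, hρ₂, LinearMap.sum_apply,
      ← Finset.add_sum_erase _ _ (Finset.mem_univ i)]
    rfl
  · intro a b
    rw [hρ₂]
    exact Commute.sum_right _ _ _ fun m hm =>
      commute_factorEnd_of_ne (Finset.ne_of_mem_erase hm).symm _ _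
  · intro a
    rw [hρ₂]
    exact Finset.sum_eq_zero fun m hm => hne i m (Finset.ne_of_mem_erase hm) a
  · rw [mul_assoc, ← mul_assoc (factorEnd j p') (factorEnd i p), ← hpp.eq,
      mul_assoc (factorEnd i p), ← map_mul _ p' p', hp'.idem, ← mul_assoc, ← map_mul, hp.idem]
  · exact fun a => (hcp i a).mul_left (hcp' i a)
  · intro a
    rw [hρ₂]
    exact Commute.sum_right _ _ _ fun m _ => (hcp m a).mul_left (hcp' m a)
  · intro l a
    rw [hρ₂]
    exact Commute.sum_right _ _ _ fun m hm =>
      (hcp' m a).mul_left (hcr l m (Finset.ne_of_mem_erase hm) a)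
  · rw [hpp.eq, hs, map_sum, Finset.mul_sum]
    refine Finset.sum_congr rfl fun l _ => ?_
    rw [map_mul, mul_assoc]; rfl
  · exact fun l a => (hcp i a).mul_left (commute_factorEnd_of_ne hij.symm _ _)
  · have h1 : ∀ l, ρ₂ (T j l) = ρ j l := fun l => by
      rw [hρ₂, Finset.sum_eq_single_of_mem j (Finset.mem_erase.2 ⟨hij.symm, Finset.mem_univ j⟩)
        fun m _ hm => hne j m hm l, hself]
    rw [hs', map_sum, Finset.mul_sum]
    refine Finset.sum_congr rfl fun l _ => ?_
    rw [h1, map_mul, mul_assoc]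
    rfl

end Vanishing

/-! ### The left ideal generated by the action -/

section ExistsSum

variable {k : Type*} {L : Type*} {M : Type*} [Field k] [LieRing L] [LieAlgebra k L]
  [AddCommGroup M] [Module k M] [LieRingModule L M] [LieModule k L M]

/-- Finitely many elements of `L` suffice to detect invariance in a finite-dimensional module. -/
theorem exists_finset_forall_lie_eq_zero [FiniteDimensional k M] :
    ∃ s : Finset L, ∀ m : M, (∀ l ∈ s, ⁅l, m⁆ = 0) → ∀ l : L, ⁅l, m⁆ = 0 := by
  classical
  let φ : L →ₗ[k] Module.End k M :=
    { toFun := fun a => LieModule.toEnd k L M a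
      map_add' := fun a b => by rw [map_add]
      map_smul' := fun c a => by rw [map_smul, RingHom.id_apply] }
  obtain ⟨t, ht⟩ := IsNoetherian.noetherian (LinearMap.range φ)
  have hpre : ∀ f : t, ∃ a, φ a = f := fun f =>
    LinearMap.mem_range.1 (ht ▸ Submodule.subset_span f.2)
  choose a ha using hpre
  refine ⟨Finset.univ.image a, fun m hm l => ?_⟩
  have h : Submodule.span k (t : Set (Module.End k M)) ≤
      LinearMap.ker (LinearMap.applyₗ (R := k) (M₂ := M) m) := by
    refine Submodule.span_le.2 fun f hf => ?_
    have := hm _ (Finset.mem_image_of_mem a (Finset.mem_univ ⟨f, hf⟩))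
    have hf' : φ (a ⟨f, hf⟩) = f := ha ⟨f, hf⟩
    rw [SetLike.mem_coe, LinearMap.mem_ker, LinearMap.applyₗ_apply_apply, ← hf']
    exact this
  have hl : φ l ∈ Submodule.span k (t : Set (Module.End k M)) := ht ▸ LinearMap.mem_range_self φ l
  exact h hl

/-- An endomorphism which kills the invariants lies in the left ideal generated by the action. -/
theorem exists_sum_mul_toEnd [FiniteDimensional k M] {p : Module.End k M}
    (hp : ∀ m, (∀ l : L, ⁅l, m⁆ = 0) → p m = 0) :
    ∃ (s : Finset L) (r : L → Module.End k M), p = ∑ l ∈ s, r l * LieModule.toEnd k L M l := by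
  classical
  obtain ⟨s, hs⟩ := exists_finset_forall_lie_eq_zero (k := k) (L := L) (M := M)
  let Φ : M →ₗ[k] (s → M) := LinearMap.pi fun l => LieModule.toEnd k L M l.1
  have hΦ : LinearMap.ker Φ ≤ LinearMap.ker p := fun m hm =>
    hp m (hs m fun l hl => congrFun hm ⟨l, hl⟩)
  obtain ⟨h, hh⟩ : ∃ h : (s → M) →ₗ[k] M, h ∘ₗ Φ = p := by
    obtain ⟨h, hh⟩ := LinearMap.exists_extend
      ((LinearMap.ker Φ).liftQ p hΦ ∘ₗ Φ.quotKerEquivRange.symm.toLinearMap)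
    refine ⟨h, LinearMap.ext fun m => ?_⟩
    have h1 := LinearMap.congr_fun hh ⟨Φ m, LinearMap.mem_range_self Φ m⟩
    have h2 : Φ.quotKerEquivRange.symm ⟨Φ m, LinearMap.mem_range_self Φ m⟩ =
        Submodule.Quotient.mk m := by
      rw [LinearEquiv.symm_apply_eq]; rfl
    rw [LinearMap.comp_apply, LinearMap.comp_apply, LinearEquiv.coe_coe, h2] at h1
    exact h1
  refine ⟨s, fun l => if hl : l ∈ s then h ∘ₗ LinearMap.single k (fun _ => M) ⟨l, hl⟩ else 0, ?_⟩
  ext m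
  have h1 : Φ m = ∑ l : s, Pi.single l ⁅l.1, m⁆ :=
    (Finset.univ_sum_single (Φ m)).symm
  rw [← hh, ← Finset.sum_attach, LinearMap.sum_apply, LinearMap.comp_apply, h1, map_sum]
  refine Finset.sum_congr rfl fun l _ => ?_
  simp

end ExistsSum

/-! ### Functoriality of `H¹` -/

section H1

variable {k : Type*} {L : Type*} [Field k] [LieRing L] [LieAlgebra k L]
variable {W : Type*} [AddCommGroup W] [Module k W] [LieRingModule L W] [LieModule k L W]
variable {W' : Type*} [AddCommGroup W'] [Module k W'] [LieRingModule L W'] [LieModule k L W']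
variable {W'' : Type*} [AddCommGroup W''] [Module k W''] [LieRingModule L W''] [LieModule k L W'']

/-- Composition of a derivation with a homomorphism of modules. -/
def derMap (f : W →ₗ⁅k,L⁆ W') : LieDerivation k L W →ₗ[k] LieDerivation k L W' where
  toFun D :=
    { (f : W →ₗ[k] W') ∘ₗ (D : L →ₗ[k] W) with
      leibniz' := fun a b => by
        change f (D ⁅a, b⁆) = ⁅a, f (D b)⁆ - ⁅b, f (D a)⁆
        rw [LieDerivation.apply_lie_eq_sub, map_sub, f.map_lie, f.map_lie] }
  map_add' D D' := LieDerivation.ext fun a => map_add f (D a) (D' a)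
  map_smul' c D := LieDerivation.ext fun a => map_smul f c (D a)

variable (k L) in
/-- The class in `H¹(L, W)` of a derivation. -/
abbrev H1.mk : LieDerivation k L W →ₗ[k] H1 k L W :=
  Submodule.mkQ (LinearMap.range (LieDerivation.inner k L W))

theorem H1.mk_eq_zero_iff (D : LieDerivation k L W) :
    H1.mk k L D = 0 ↔ ∃ w, ∀ a, D a = ⁅a, w⁆ := by
  rw [Submodule.mkQ_apply, Submodule.Quotient.mk_eq_zero, LinearMap.mem_range]
  refine exists_congr fun w => ⟨?_, fun h => LieDerivation.ext fun a => (h a).symm⟩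
  rintro rfl a
  rfl

/-- The map `H¹(L, W) → H¹(L, W')` induced by a homomorphism of modules. -/
def H1.map (f : W →ₗ⁅k,L⁆ W') : H1 k L W →ₗ[k] H1 k L W' :=
  Submodule.mapQ _ _ (derMap f) (by
    rintro _ ⟨w, rfl⟩
    refine ⟨f w, LieDerivation.ext fun a => ?_⟩
    exact (f.map_lie a w).symm)

@[simp] theorem H1.map_mk (f : W →ₗ⁅k,L⁆ W') (D : LieDerivation k L W) :
    H1.map f (H1.mk k L D) = H1.mk k L (derMap f D) := rfl

theorem H1.map_map (g : W' →ₗ⁅k,L⁆ W'') (f : W →ₗ⁅k,L⁆ W') (c : H1 k L W) :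
    H1.map g (H1.map f c) = H1.map (g.comp f) c := by
  obtain ⟨D, rfl⟩ := Submodule.mkQ_surjective _ c
  rfl

theorem H1.map_id (c : H1 k L W) : H1.map (LieModuleHom.id : W →ₗ⁅k,L⁆ W) c = c := by
  obtain ⟨D, rfl⟩ := Submodule.mkQ_surjective _ c
  rfl

theorem H1.map_add (f g : W →ₗ⁅k,L⁆ W') (c : H1 k L W) :
    H1.map (f + g) c = H1.map f c + H1.map g c := by
  obtain ⟨D, rfl⟩ := Submodule.mkQ_surjective _ c
  rfl

theorem H1.map_zero (c : H1 k L W) : H1.map (0 : W →ₗ⁅k,L⁆ W') c = 0 := by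
  obtain ⟨D, rfl⟩ := Submodule.mkQ_surjective _ c
  rfl

theorem H1.map_sum {α : Type*} (s : Finset α) (f : α → (W →ₗ⁅k,L⁆ W')) (c : H1 k L W) :
    H1.map (∑ a ∈ s, f a) c = ∑ a ∈ s, H1.map (f a) c := by
  classical
  induction s using Finset.induction_on with
  | empty => exact H1.map_zero c
  | insert a s ha ih => rw [Finset.sum_insert ha, Finset.sum_insert ha, H1.map_add, ih]

/-- Isomorphic modules have isomorphic `H¹`. -/
def H1.congr (e : W ≃ₗ⁅k,L⁆ W') : H1 k L W ≃ₗ[k] H1 k L W' :=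
  LinearEquiv.ofLinearMap (H1.map e.toLieModuleHom) (H1.map e.symm.toLieModuleHom)
    (LinearMap.ext fun c => by
      obtain ⟨D, rfl⟩ := Submodule.mkQ_surjective _ c
      exact congrArg (H1.mk k L) (LieDerivation.ext fun a => e.apply_symm_apply (D a)))
    (LinearMap.ext fun c => by
      obtain ⟨D, rfl⟩ := Submodule.mkQ_surjective _ c
      exact congrArg (H1.mk k L) (LieDerivation.ext fun a => e.symm_apply_apply (D a)))

/-- An invariant linear form `τ` on `W` maps the class of a derivation `D` to the linear form
`τ ∘ D`, which vanishes on `[L, L]`. -/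
def H1.toDual (τ : Module.Dual k W) (hτ : ∀ (a : L) (w : W), τ ⁅a, w⁆ = 0) :
    H1 k L W →ₗ[k] Module.Dual k (Abelianization k L) :=
  Submodule.liftQ _
    { toFun := fun D => Submodule.liftQ
        (LieSubmodule.toSubmodule (⁅(⊤ : LieIdeal k L), (⊤ : LieIdeal k L)⁆ : LieIdeal k L))
          (τ ∘ₗ (D : L →ₗ[k] W)) (by
          rw [LieSubmodule.lieIdeal_oper_eq_linear_span', Submodule.span_le]
          rintro _ ⟨a, -, b, -, rfl⟩
          change τ (D ⁅a, b⁆) = 0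
          rw [LieDerivation.apply_lie_eq_sub, _root_.map_sub, hτ, hτ, sub_zero])
      map_add' := fun D D' => by
        refine Submodule.linearMap_qext _ (LinearMap.ext fun a => ?_)
        exact _root_.map_add τ (D a) (D' a)
      map_smul' := fun c D => by
        refine Submodule.linearMap_qext _ (LinearMap.ext fun a => ?_)
        exact _root_.map_smul τ c (D a) }
    (by
      rintro _ ⟨w, rfl⟩
      refine Submodule.linearMap_qext _ (LinearMap.ext fun a => ?_)
      exact hτ a w)

/-- The class of the derivation `a ↦ φ(a) w` attached to a linear form `φ` on `L / [L, L]` and an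
invariant vector `w`. -/
def H1.ofDual (w : W) (hw : ∀ a : L, ⁅a, w⁆ = 0) :
    Module.Dual k (Abelianization k L) →ₗ[k] H1 k L W :=
  H1.mk k L ∘ₗ
    { toFun := fun φ =>
        { (φ ∘ₗ Submodule.mkQ _).smulRight w with
          leibniz' := fun a b => by
            have h : (Submodule.Quotient.mk ⁅a, b⁆ : Abelianization k L) = 0 :=
              (Submodule.Quotient.mk_eq_zero _).2
                (LieSubmodule.lie_mem_lie (LieSubmodule.mem_top a) (LieSubmodule.mem_top b))
            change φ (Submodule.Quotient.mk ⁅a, b⁆) • w = ⁅a, φ _ • w⁆ - ⁅b, φ _ • w⁆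
            rw [h, _root_.map_zero, zero_smul, lie_smul, lie_smul, hw, hw, smul_zero, smul_zero,
              sub_zero] }
      map_add' := fun φ φ' => LieDerivation.ext fun a => add_smul _ _ w
      map_smul' := fun c φ => LieDerivation.ext fun a => mul_smul c _ w }

theorem H1.toDual_ofDual (τ : Module.Dual k W) (hτ : ∀ (a : L) (w : W), τ ⁅a, w⁆ = 0)
    (w : W) (hw : ∀ a : L, ⁅a, w⁆ = 0) (h : τ w = 1) (φ : Module.Dual k (Abelianization k L)) :
    H1.toDual τ hτ (H1.ofDual w hw φ) = φ := by
  refine Submodule.linearMap_qext _ (LinearMap.ext fun a => ?_)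
  change τ (φ _ • w) = φ _
  rw [_root_.map_smul, h, smul_eq_mul, mul_one]

theorem H1.ofDual_toDual (τ : Module.Dual k W) (hτ : ∀ (a : L) (w : W), τ ⁅a, w⁆ = 0)
    (w : W') (hw : ∀ a : L, ⁅a, w⁆ = 0) (c : H1 k L W) (f : W →ₗ⁅k,L⁆ W')
    (hf : ∀ v, f v = τ v • w) :
    H1.ofDual w hw (H1.toDual τ hτ c) = H1.map f c := by
  obtain ⟨D, rfl⟩ := Submodule.mkQ_surjective _ c
  refine congrArg (H1.mk k L) (LieDerivation.ext fun a => ?_)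
  exact (hf (D a)).symm

theorem H1.map_ofDual (f : W →ₗ⁅k,L⁆ W') (w : W) (hw : ∀ a : L, ⁅a, w⁆ = 0)
    (hw' : ∀ a : L, ⁅a, f w⁆ = 0) (φ : Module.Dual k (Abelianization k L)) :
    H1.map f (H1.ofDual w hw φ) = H1.ofDual (f w) hw' φ := by
  refine congrArg (H1.mk k L) (LieDerivation.ext fun a => ?_)
  exact _root_.map_smul f _ w

theorem H1.toDual_map (f : W →ₗ⁅k,L⁆ W') (τ : Module.Dual k W')
    (hτ : ∀ (a : L) (w : W'), τ ⁅a, w⁆ = 0) (τ' : Module.Dual k W)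
    (hτ' : ∀ (a : L) (w : W), τ' ⁅a, w⁆ = 0) (h : ∀ w, τ (f w) = τ' w) (c : H1 k L W) :
    H1.toDual τ hτ (H1.map f c) = H1.toDual τ' hτ' c := by
  obtain ⟨D, rfl⟩ := Submodule.mkQ_surjective _ c
  refine Submodule.linearMap_qext _ (LinearMap.ext fun a => ?_)
  exact h (D a)

end H1

/-! ### Insertion and contraction -/

section TensorMaps

variable {k : Type*} [Field k] {ι : Type*} {V : ι → Type*}
  [∀ i, AddCommGroup (V i)] [∀ i, Module k (V i)]

open scoped Classical in
/-- The insertion of a vector as the `i`-th factor of a tensor whose other factors are `u j`. -/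
def insertAt (u : ∀ j, V j) (i : ι) : V i →ₗ[k] ⨂[k] j, V j :=
  (PiTensorProduct.tprod k).toLinearMap u i

open scoped Classical in
theorem insertAt_apply (u : ∀ j, V j) (i : ι) (v : V i) :
    insertAt (k := k) u i v = PiTensorProduct.tprod k (Function.update u i v) := rfl

theorem insertAt_self (u : ∀ i, V i) (i : ι) :
    insertAt u i (u i) = PiTensorProduct.tprod k u := by
  classical
  rw [insertAt_apply, Function.update_eq_self]

theorem factorEnd_insertAt (u : ∀ j, V j) (i : ι) (f : Module.End k (V i)) (v : V i) :
    factorEnd i f (insertAt u i v) = insertAt u i (f v) := by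
  classical
  rw [insertAt_apply, insertAt_apply, factorEnd_tprod, Function.update_self, Function.update_idem]

theorem factorEnd_insertAt_of_ne (u : ∀ j, V j) {i j : ι} (hij : j ≠ i) (f : Module.End k (V j))
    (hf : f (u j) = 0) (v : V i) : factorEnd j f (insertAt u i v) = 0 := by
  classical
  rw [insertAt_apply, factorEnd_tprod, Function.update_of_ne hij, hf]
  exact (PiTensorProduct.tprod k).map_coord_zero j (Function.update_self ..)

variable [Fintype ι]

open scoped Classical in
/-- The contraction of all tensor factors except the `i`-th with linear forms `ξ j`. -/
def contractAt (ξ : ∀ j, Module.Dual k (V j)) (i : ι) : (⨂[k] j, V j) →ₗ[k] V i :=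
  PiTensorProduct.lift <| MultilinearMap.mk' (fun v => (∏ j ∈ Finset.univ.erase i, ξ j (v j)) • v i)
    (fun v j x y => by
      by_cases h : j = i
      · subst h
        have h1 : ∀ z, ∏ l ∈ Finset.univ.erase j, ξ l (Function.update v j z l) =
            ∏ l ∈ Finset.univ.erase j, ξ l (v l) := fun z =>
          Finset.prod_congr rfl fun l hl => by
            rw [Function.update_of_ne (Finset.ne_of_mem_erase hl)]
        simp only [h1, Function.update_self, smul_add]
      · have hj : j ∈ Finset.univ.erase i := Finset.mem_erase.2 ⟨h, Finset.mem_univ j⟩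
        have h1 : ∀ z, ∏ l ∈ Finset.univ.erase i, ξ l (Function.update v j z l) =
            ξ j z * ∏ l ∈ (Finset.univ.erase i).erase j, ξ l (v l) := fun z => by
          rw [← Finset.mul_prod_erase _ _ hj, Function.update_self]
          congr 1
          exact Finset.prod_congr rfl fun l hl => by
            rw [Function.update_of_ne (Finset.ne_of_mem_erase hl)]
        simp only [h1, Function.update_of_ne (Ne.symm h), map_add, add_mul, add_smul])
    (fun v j c x => by
      by_cases h : j = i
      · subst h
        have h1 : ∀ z, ∏ l ∈ Finset.univ.erase j, ξ l (Function.update v j z l) =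
            ∏ l ∈ Finset.univ.erase j, ξ l (v l) := fun z =>
          Finset.prod_congr rfl fun l hl => by
            rw [Function.update_of_ne (Finset.ne_of_mem_erase hl)]
        simp only [h1, Function.update_self]
        rw [smul_comm]
      · have hj : j ∈ Finset.univ.erase i := Finset.mem_erase.2 ⟨h, Finset.mem_univ j⟩
        have h1 : ∀ z, ∏ l ∈ Finset.univ.erase i, ξ l (Function.update v j z l) =
            ξ j z * ∏ l ∈ (Finset.univ.erase i).erase j, ξ l (v l) := fun z => by
          rw [← Finset.mul_prod_erase _ _ hj, Function.update_self]
          congr 1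
          exact Finset.prod_congr rfl fun l hl => by
            rw [Function.update_of_ne (Finset.ne_of_mem_erase hl)]
        simp only [h1, Function.update_of_ne (Ne.symm h), map_smul, smul_eq_mul, mul_smul])

open scoped Classical in
theorem contractAt_tprod (ξ : ∀ j, Module.Dual k (V j)) (i : ι) (v : ∀ j, V j) :
    contractAt ξ i (PiTensorProduct.tprod k v) =
      (∏ j ∈ Finset.univ.erase i, ξ j (v j)) • v i :=
  PiTensorProduct.lift.tprod v

theorem contractAt_insertAt (ξ : ∀ j, Module.Dual k (V j)) (u : ∀ j, V j) (i : ι)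
    (h : ∀ j, j ≠ i → ξ j (u j) = 1) (v : V i) : contractAt ξ i (insertAt u i v) = v := by
  classical
  rw [insertAt_apply, contractAt_tprod, Function.update_self]
  convert one_smul k v
  refine Finset.prod_eq_one fun j hj => ?_
  rw [Function.update_of_ne (Finset.ne_of_mem_erase hj), h j (Finset.ne_of_mem_erase hj)]

theorem contractAt_insertAt_of_ne (ξ : ∀ j, Module.Dual k (V j)) (u : ∀ j, V j) {i j : ι}
    (hij : i ≠ j) (h : ∀ j, ξ j (u j) = 1) (v : V j) :
    contractAt ξ i (insertAt u j v) = ξ j v • u i := by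
  classical
  rw [insertAt_apply, contractAt_tprod, Function.update_of_ne hij,
    Finset.prod_eq_single_of_mem j (Finset.mem_erase.2 ⟨hij.symm, Finset.mem_univ j⟩),
    Function.update_self]
  intro l _ hl
  rw [Function.update_of_ne hl, h]

theorem contractAt_factorEnd (ξ : ∀ j, Module.Dual k (V j)) (i : ι) (f : Module.End k (V i))
    (t : ⨂[k] j, V j) : contractAt ξ i (factorEnd i f t) = f (contractAt ξ i t) := by
  classical
  suffices h : contractAt ξ i ∘ₗ factorEnd i f = f ∘ₗ contractAt ξ i from LinearMap.congr_fun h t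
  refine PiTensorProduct.ext (MultilinearMap.ext fun v => ?_)
  simp only [LinearMap.compMultilinearMap_apply, LinearMap.comp_apply, factorEnd_tprod,
    contractAt_tprod, Function.update_self, map_smul]
  congr 1
  exact Finset.prod_congr rfl fun j hj => by rw [Function.update_of_ne (Finset.ne_of_mem_erase hj)]

theorem contractAt_factorEnd_of_ne (ξ : ∀ j, Module.Dual k (V j)) {i j : ι} (hij : j ≠ i)
    (f : Module.End k (V j)) (hf : ∀ v, ξ j (f v) = 0) (t : ⨂[k] j, V j) :
    contractAt ξ i (factorEnd j f t) = 0 := by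
  classical
  suffices h : contractAt ξ i ∘ₗ factorEnd j f = 0 from LinearMap.congr_fun h t
  refine PiTensorProduct.ext (MultilinearMap.ext fun v => ?_)
  simp only [LinearMap.compMultilinearMap_apply, LinearMap.comp_apply, factorEnd_tprod,
    contractAt_tprod, LinearMap.zero_apply]
  rw [Finset.prod_eq_zero (Finset.mem_erase.2 ⟨hij, Finset.mem_univ j⟩), zero_smul]
  rw [Function.update_self, hf]

end TensorMaps

/-! ### Homomorphisms between tensor products of modules -/

section TensorHoms

variable {k : Type*} {L : Type*} [Field k] [LieRing L] [LieAlgebra k L] {ι : Type*} [Fintype ι]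
  {V : ι → Type*} [∀ i, AddCommGroup (V i)] [∀ i, Module k (V i)] [∀ i, LieRingModule L (V i)]
  [∀ i, LieModule k L (V i)]
  {V' : ι → Type*} [∀ i, AddCommGroup (V' i)] [∀ i, Module k (V' i)] [∀ i, LieRingModule L (V' i)]
  [∀ i, LieModule k L (V' i)]

/-- The tensor product of homomorphisms of modules. -/
def tensorHom (f : ∀ i, V i →ₗ⁅k,L⁆ V' i) : (⨂[k] i, V i) →ₗ⁅k,L⁆ ⨂[k] i, V' i :=
  { PiTensorProduct.map fun i => (f i : V i →ₗ[k] V' i) with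
    map_lie' := by
      classical
      intro l t
      suffices h : PiTensorProduct.map (fun i => (f i : V i →ₗ[k] V' i)) ∘ₗ tensorAct V l =
          tensorAct V' l ∘ₗ PiTensorProduct.map fun i => (f i : V i →ₗ[k] V' i) from
        LinearMap.congr_fun h t
      refine PiTensorProduct.ext (MultilinearMap.ext fun v => ?_)
      change PiTensorProduct.map (fun i => (f i : V i →ₗ[k] V' i)) ⁅l, PiTensorProduct.tprod k v⁆ =
        ⁅l, PiTensorProduct.map (fun i => (f i : V i →ₗ[k] V' i)) (PiTensorProduct.tprod k v)⁆
      rw [PiTensorProduct.map_tprod, lie_tprod, lie_tprod, map_sum]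
      refine Finset.sum_congr rfl fun i _ => ?_
      rw [PiTensorProduct.map_tprod]
      congr 1
      funext j
      by_cases h : j = i
      · subst h; simp
      · simp [Function.update_of_ne h] }

theorem tensorHom_apply (f : ∀ i, V i →ₗ⁅k,L⁆ V' i) (t : ⨂[k] i, V i) :
    tensorHom f t = PiTensorProduct.map (fun i => (f i : V i →ₗ[k] V' i)) t := rfl

theorem tensorHom_tprod (f : ∀ i, V i →ₗ⁅k,L⁆ V' i) (v : ∀ i, V i) :
    tensorHom f (PiTensorProduct.tprod k v) = PiTensorProduct.tprod k fun i => f i (v i) :=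
  PiTensorProduct.map_tprod _ _

theorem tensorHom_ext {W : Type*} [AddCommGroup W] [Module k W] [LieRingModule L W]
    {f g : (⨂[k] i, V i) →ₗ⁅k,L⁆ W}
    (h : ∀ v, f (PiTensorProduct.tprod k v) = g (PiTensorProduct.tprod k v)) : f = g :=
  LieModuleHom.ext fun t => LinearMap.congr_fun (PiTensorProduct.ext (MultilinearMap.ext h) :
    (f : (⨂[k] i, V i) →ₗ[k] W) = g) t

/-- Tensor products of isomorphic modules are isomorphic. -/
def tensorCongr (e : ∀ i, V i ≃ₗ⁅k,L⁆ V' i) : (⨂[k] i, V i) ≃ₗ⁅k,L⁆ ⨂[k] i, V' i :=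
  { PiTensorProduct.congr fun i => (e i).toLinearEquiv with
    map_lie' := fun {l t} => (tensorHom fun i => (e i).toLieModuleHom).map_lie l t }

/-- Insertion into a tensor with invariant factors, as a homomorphism of modules. -/
def insertHom (u : ∀ j, V j) (i : ι) (hu : ∀ j, j ≠ i → ∀ l : L, ⁅l, u j⁆ = 0) :
    V i →ₗ⁅k,L⁆ ⨂[k] j, V j :=
  { insertAt u i with
    map_lie' := by
      classical
      intro l v
      change insertAt u i ⁅l, v⁆ = ⁅l, insertAt u i v⁆
      rw [lie_eq_sum_factorEnd, Finset.sum_eq_single_of_mem i (Finset.mem_univ i),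
        factorEnd_insertAt]
      · rfl
      · exact fun j _ hj => factorEnd_insertAt_of_ne u hj _ (hu j hj l) v }

/-- Contraction with invariant linear forms, as a homomorphism of modules. -/
def contractHom (ξ : ∀ j, Module.Dual k (V j)) (i : ι)
    (hξ : ∀ j, j ≠ i → ∀ (l : L) (v : V j), ξ j ⁅l, v⁆ = 0) : (⨂[k] j, V j) →ₗ⁅k,L⁆ V i :=
  { contractAt ξ i with
    map_lie' := by
      classical
      intro l t
      change contractAt ξ i ⁅l, t⁆ = ⁅l, contractAt ξ i t⁆
      rw [lie_eq_sum_factorEnd, map_sum, Finset.sum_eq_single_of_mem i (Finset.mem_univ i),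
        contractAt_factorEnd]
      · rfl
      · exact fun j _ hj => contractAt_factorEnd_of_ne ξ hj _ (hξ j hj l) t }

end TensorHoms

/-! ### Modules with split one-dimensional invariants -/

section Split

variable {k : Type*} {L : Type*} [Field k] [LieRing L] [LieAlgebra k L]

/-- The invariants of the module `M` are spanned by the vector `u`, and the kernel of the invariant
linear form `τ`, with `τ u = 1`, is a complement of them. -/
structure IsSplitUnit {M : Type*} [AddCommGroup M] [Module k M] [LieRingModule L M]
    [LieModule k L M] (u : M) (τ : Module.Dual k M) : Prop where
  lie_unit : ∀ l : L, ⁅l, u⁆ = 0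
  form_lie : ∀ (l : L) (m : M), τ ⁅l, m⁆ = 0
  form_unit : τ u = 1
  eq_smul : ∀ m : M, (∀ l : L, ⁅l, m⁆ = 0) → m = τ m • u

variable {M : Type*} [AddCommGroup M] [Module k M] [LieRingModule L M]
  [LieModule k L M] {u : M} {τ : Module.Dual k M}

/-- The projection onto the invariants. -/
def IsSplitUnit.unitProj (h : IsSplitUnit (L := L) u τ) : M →ₗ⁅k,L⁆ M :=
  { τ.smulRight u with
    map_lie' := fun {l m} => by
      change τ ⁅l, m⁆ • u = ⁅l, τ m • u⁆
      rw [h.form_lie, lie_smul, h.lie_unit, zero_smul, smul_zero] }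

theorem IsSplitUnit.isActionProj [FiniteDimensional k M] (h : IsSplitUnit (L := L) u τ) :
    IsActionProj (L := L) ((LieModuleHom.id - h.unitProj : M →ₗ⁅k,L⁆ M) : M →ₗ[k] M) where
  idem := by
    ext m
    change (m - τ m • u) - τ (m - τ m • u) • u = m - τ m • u
    rw [map_sub, map_smul, h.form_unit, smul_eq_mul, mul_one, sub_self, zero_smul, sub_zero]
  comm l := by
    ext m
    exact LieModuleHom.map_lie (LieModuleHom.id - h.unitProj) l m
  exists_sum := exists_sum_mul_toEnd fun m hm => by
    change m - τ m • u = 0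
    rw [← h.eq_smul m hm, sub_self]

theorem isActionProj_id [FiniteDimensional k M] (h : ∀ m : M, (∀ l : L, ⁅l, m⁆ = 0) → m = 0) :
    IsActionProj (L := L) ((LieModuleHom.id : M →ₗ⁅k,L⁆ M) : M →ₗ[k] M) where
  idem := rfl
  comm _ := rfl
  exists_sum := exists_sum_mul_toEnd h

end Split

/-! ### `H¹` of a tensor product -/

section Decomposition

theorem sum_finset_eq_add_sum_singleton {ι X : Type*} [Fintype ι] [DecidableEq ι]
    [AddCommMonoid X] (F : Finset ι → X)
    (hF : ∀ (s : Finset ι) (i j), i ∈ s → j ∈ s → i ≠ j → F s = 0) :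
    ∑ s, F s = F ∅ + ∑ i, F {i} := by
  have h : ∑ s ∈ insert ∅ (Finset.univ.image fun i : ι => ({i} : Finset ι)), F s = ∑ s, F s := by
    refine Finset.sum_subset (Finset.subset_univ _) fun s _ hs => ?_
    obtain ⟨i, hi⟩ : s.Nonempty := Finset.nonempty_iff_ne_empty.2 fun e =>
      hs (e ▸ Finset.mem_insert_self _ _)
    obtain ⟨j, hj, hij⟩ : ∃ j ∈ s, j ≠ i := by
      by_contra! hne
      refine hs (Finset.mem_insert_of_mem (Finset.mem_image.2 ⟨i, Finset.mem_univ i, ?_⟩))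
      exact ((Finset.eq_singleton_iff_unique_mem).2 ⟨hi, hne⟩).symm
    exact hF s j i hj hi hij
  rw [← h, Finset.sum_insert, Finset.sum_image]
  · exact fun _ _ _ _ e => Finset.singleton_injective e
  · intro h0
    obtain ⟨i, -, hi⟩ := Finset.mem_image.1 h0
    exact Finset.singleton_ne_empty i hi

variable {k : Type*} {L : Type*} [Field k] [LieRing L] [LieAlgebra k L]
variable {ι : Type*} [Fintype ι] {V : ι → Type*} [∀ i, AddCommGroup (V i)]
  [∀ i, Module k (V i)] [∀ i, LieRingModule L (V i)] [∀ i, LieModule k L (V i)]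

/-- The vanishing of `H¹` on the part of a tensor product which is nontrivial in two factors. -/
theorem IsSeparating.map_tensorHom_eq_zero {T : ι → L →ₗ[k] L} (hT : IsSeparating k V T)
    (f : ∀ i, V i →ₗ⁅k,L⁆ V i) {i j : ι} (hij : i ≠ j)
    (hi : IsActionProj (L := L) (f i : V i →ₗ[k] V i))
    (hj : IsActionProj (L := L) (f j : V j →ₗ[k] V j)) (c : H1 k L (⨂[k] i, V i)) :
    H1.map (tensorHom f) c = 0 := by
  classical
  obtain ⟨D, rfl⟩ := Submodule.mkQ_surjective _ c
  rw [H1.map_mk, H1.mk_eq_zero_iff]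
  obtain ⟨w, hw⟩ := hT.exists_inner hij hi hj (derMap (tensorHom f) D)
  refine ⟨w, fun a => (Eq.trans ?_ (hw a))⟩
  -- `f i` and `f j` are idempotent, so they can be applied once more
  suffices h : ∀ t, tensorHom f t = factorEnd i (f i : V i →ₗ[k] V i)
      (factorEnd j (f j : V j →ₗ[k] V j) (tensorHom f t)) from h (D a)
  intro t
  rw [tensorHom_apply, factorEnd_apply, factorEnd_apply]
  simp only [← LinearMap.comp_apply, ← PiTensorProduct.map_comp]
  congr 2
  funext l
  by_cases h : l = i
  · subst h
    rw [Function.update_self, Function.update_of_ne hij, LinearMap.id_comp]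
    exact hi.idem.symm
  · rw [Function.update_of_ne h]
    by_cases h' : l = j
    · subst h'
      rw [Function.update_self]
      exact hj.idem.symm
    · rw [Function.update_of_ne h']
      rfl

open scoped Classical in
/-- If `p i + q i = id` in each factor, then on `H¹` the identity is the sum of those terms of the
expansion of `⨂ (p i + q i)` which contain at most one `p i`. -/
theorem IsSeparating.eq_add_sum {T : ι → L →ₗ[k] L} (hT : IsSeparating k V T)
    (p q : ∀ i, V i →ₗ⁅k,L⁆ V i) (hp : ∀ i, IsActionProj (L := L) (p i : V i →ₗ[k] V i))
    (hpq : ∀ i v, p i v + q i v = v) (c : H1 k L (⨂[k] i, V i)) :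
    c = H1.map (tensorHom q) c + ∑ i, H1.map (tensorHom (Function.update q i (p i))) c := by
  have h1 : (LieModuleHom.id : (⨂[k] i, V i) →ₗ⁅k,L⁆ _) =
      ∑ s : Finset ι, tensorHom (s.piecewise p q) := by
    refine tensorHom_ext fun v => ?_
    have h2 := (PiTensorProduct.tprod k).map_add_univ (fun i => p i (v i)) (fun i => q i (v i))
    have h3 : (fun i => p i (v i)) + (fun i => q i (v i)) = v := funext fun i => hpq i (v i)
    rw [h3] at h2
    have h4 : ∀ (S : Finset (Finset ι)) (f : Finset ι → ((⨂[k] i, V i) →ₗ⁅k,L⁆ ⨂[k] i, V i)) t,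
        (∑ s ∈ S, f s) t = ∑ s ∈ S, f s t := fun S f t => by
      induction S using Finset.induction_on with
      | empty => rfl
      | insert a S ha ih =>
        rw [Finset.sum_insert ha, Finset.sum_insert ha, ← ih]; rfl
    rw [h4, LieModuleHom.id_apply]
    refine h2.trans (Finset.sum_congr rfl fun s _ => ?_)
    rw [tensorHom_tprod]
    congr 1
    funext i
    by_cases h : i ∈ s <;> simp [h]
  have h5 := H1.map_id c
  rw [h1, H1.map_sum, sum_finset_eq_add_sum_singleton] at h5
  · rw [Finset.piecewise_empty] at h5
    refine h5.symm.trans (congrArg _ (Finset.sum_congr rfl fun i _ => ?_))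
    rw [Finset.piecewise_singleton]
  · intro s i j hi hj hij
    exact hT.map_tensorHom_eq_zero _ hij (by rw [Finset.piecewise_eq_of_mem _ _ _ hi]; exact hp i)
      (by rw [Finset.piecewise_eq_of_mem _ _ _ hj]; exact hp j) c

/-- `H¹` of a tensor product vanishes if two factors have no invariants. -/
theorem IsSeparating.subsingleton_H1 {T : ι → L →ₗ[k] L} (hT : IsSeparating k V T)
    [∀ i, FiniteDimensional k (V i)] {i j : ι} (hij : i ≠ j)
    (hi : ∀ v : V i, (∀ l : L, ⁅l, v⁆ = 0) → v = 0)
    (hj : ∀ v : V j, (∀ l : L, ⁅l, v⁆ = 0) → v = 0) : Subsingleton (H1 k L (⨂[k] i, V i)) := by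
  refine subsingleton_of_forall_eq 0 fun c => ?_
  rw [← hT.map_tensorHom_eq_zero (fun _ => LieModuleHom.id) hij (isActionProj_id hi)
    (isActionProj_id hj) c]
  conv_lhs => rw [← H1.map_id c]
  congr 1
  refine congrArg _ (tensorHom_ext fun v => ?_)
  rw [tensorHom_tprod]
  rfl

open scoped Classical in
/-- If `q j` is the projection onto the invariants for `j ≠ i`, then the tensor product of the `q j`
and of `p` at the `i`-th place factors through the `i`-th module. -/
theorem tensorHom_update_eq (u : ∀ i, V i) (τ : ∀ i, Module.Dual k (V i)) (i : ι)
    (hu : ∀ j, j ≠ i → IsSplitUnit (L := L) (u j) (τ j)) (q : ∀ i, V i →ₗ⁅k,L⁆ V i)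
    (hq : ∀ j, j ≠ i → ∀ v, q j v = τ j v • u j) (p : V i →ₗ⁅k,L⁆ V i) :
    tensorHom (k := k) (L := L) (Function.update q i p) =
      (insertHom u i fun j hj => (hu j hj).lie_unit).comp
        (p.comp (contractHom τ i fun j hj => (hu j hj).form_lie)) := by
  refine tensorHom_ext fun v => ?_
  change _ = insertAt u i (p (contractAt τ i _))
  rw [tensorHom_tprod, contractAt_tprod, map_smul, map_smul, insertAt_apply]
  have h := (PiTensorProduct.tprod k).map_piecewise_smul (fun j => τ j (v j))
    (Function.update u i (p (v i))) (Finset.univ.erase i)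
  rw [← h]
  congr 1
  funext j
  by_cases hj : j = i
  · subst hj; simp
  · simp [hj, hq j hj]

/-- If one factor has no invariants and the invariants of the others are one-dimensional and split,
then `H¹` of the tensor product is `H¹` of this factor. -/
theorem IsSeparating.nonempty_H1_equiv_factor {T : ι → L →ₗ[k] L} (hT : IsSeparating k V T)
    [∀ i, FiniteDimensional k (V i)] (i : ι) (hi : ∀ v : V i, (∀ l : L, ⁅l, v⁆ = 0) → v = 0)
    (u : ∀ i, V i) (τ : ∀ i, Module.Dual k (V i))
    (hu : ∀ j, j ≠ i → IsSplitUnit (L := L) (u j) (τ j)) :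
    Nonempty (H1 k L (⨂[k] i, V i) ≃ₗ[k] H1 k L (V i)) := by
  classical
  let q : ∀ j, V j →ₗ⁅k,L⁆ V j := fun j => if h : j = i then 0 else (hu j h).unitProj
  have hqi : q i = 0 := dif_pos rfl
  have hq : ∀ j, j ≠ i → ∀ v, q j v = τ j v • u j := fun j hj v => by
    simp only [q, dif_neg hj]; rfl
  let I := insertHom (k := k) u i fun j hj => (hu j hj).lie_unit
  let C := contractHom (L := L) τ i fun j hj => (hu j hj).form_lie
  refine ⟨LinearEquiv.ofLinearMap (H1.map C) (H1.map I) (LinearMap.ext fun c => ?_)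
    (LinearMap.ext fun c => ?_)⟩
  · obtain ⟨D, rfl⟩ := Submodule.mkQ_surjective _ c
    exact congrArg (H1.mk k L) (LieDerivation.ext fun a =>
      contractAt_insertAt τ u i (fun j hj => (hu j hj).form_unit) (D a))
  · have h := hT.eq_add_sum (fun j => LieModuleHom.id - q j) q (fun j => by
      by_cases h : j = i
      · subst h
        rw [hqi, sub_zero]
        exact isActionProj_id hi
      · simp only [q, dif_neg h]
        exact (hu j h).isActionProj) (fun j v => sub_add_cancel v (q j v)) c
    have h0 : ∀ f : ∀ j, V j →ₗ⁅k,L⁆ V j, f i = 0 → H1.map (tensorHom f) c = 0 := fun f hf => by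
      have : tensorHom f = 0 := tensorHom_ext fun v => by
        rw [tensorHom_tprod]
        exact (PiTensorProduct.tprod k).map_coord_zero i (by rw [hf]; rfl)
      rw [this, H1.map_zero]
    rw [h0 q hqi, zero_add, Finset.sum_eq_single_of_mem i (Finset.mem_univ i) fun j _ hj =>
      h0 _ (by rw [Function.update_of_ne hj.symm, hqi]), hqi, sub_zero,
      tensorHom_update_eq u τ i hu q hq] at h
    rw [LinearMap.comp_apply, H1.map_map]
    exact h.symm

theorem form_contractAt (τ : ∀ i, Module.Dual k (V i)) (i j : ι) (t : ⨂[k] i, V i) :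
    τ i (contractAt τ i t) = τ j (contractAt τ j t) := by
  classical
  suffices h : τ i ∘ₗ contractAt τ i = τ j ∘ₗ contractAt τ j from LinearMap.congr_fun h t
  refine PiTensorProduct.ext (MultilinearMap.ext fun v => ?_)
  simp only [LinearMap.compMultilinearMap_apply, LinearMap.comp_apply, contractAt_tprod, map_smul,
    smul_eq_mul]
  rw [Finset.prod_erase_mul _ _ (Finset.mem_univ i), Finset.prod_erase_mul _ _ (Finset.mem_univ j)]

/-- The splitting of a linear map `t` with section `r`. -/
def equivProdKer {Y Z : Type*} [AddCommGroup Y] [Module k Y] [AddCommGroup Z] [Module k Z]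
    (t : Y →ₗ[k] Z) (r : Z →ₗ[k] Y) (h : ∀ z, t (r z) = z) : Y ≃ₗ[k] Z × LinearMap.ker t where
  toFun y := (t y, ⟨y - r (t y), by rw [LinearMap.mem_ker, map_sub, h, sub_self]⟩)
  invFun z := r z.1 + z.2
  map_add' y y' := Prod.ext (map_add t y y') (Subtype.ext (by
    simp only [map_add, Prod.snd_add, Submodule.coe_add]; abel))
  map_smul' c y := Prod.ext (map_smul t c y) (Subtype.ext (by
    simp [smul_sub]))
  left_inv y := add_sub_cancel _ _
  right_inv z := by
    have h1 : t (r z.1 + z.2) = z.1 := by rw [map_add, h, LinearMap.mem_ker.1 z.2.2, add_zero]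
    refine Prod.ext h1 (Subtype.ext ?_)
    change r z.1 + z.2 - r (t (r z.1 + z.2)) = z.2
    rw [h1, add_sub_cancel_left]

/-- If the invariants of all factors are one-dimensional and split, then `H¹` of the tensor product
and `H¹` of each factor contain one copy of the dual of `L / [L, L]`, and modulo these copies `H¹`
of the tensor product is the product of the `H¹` of the factors. -/
theorem IsSeparating.nonempty_prod_H1_equiv [Nonempty ι] {T : ι → L →ₗ[k] L}
    (hT : IsSeparating k V T) [∀ i, FiniteDimensional k (V i)]
    (u : ∀ i, V i) (τ : ∀ i, Module.Dual k (V i)) (hu : ∀ j, IsSplitUnit (L := L) (u j) (τ j)) :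
    Nonempty (((Fin (Fintype.card ι - 1) → Module.Dual k (Abelianization k L)) ×
      H1 k L (⨂[k] i, V i)) ≃ₗ[k] ∀ i, H1 k L (V i)) := by
  classical
  let Z := Module.Dual k (Abelianization k L)
  let i₀ : ι := Classical.arbitrary ι
  let t : ∀ i, H1 k L (V i) →ₗ[k] Z := fun i => H1.toDual (τ i) (hu i).form_lie
  let r : ∀ i, Z →ₗ[k] H1 k L (V i) := fun i => H1.ofDual (u i) (hu i).lie_unit
  have htr : ∀ i z, t i (r i z) = z := fun i z => H1.toDual_ofDual _ _ _ _ (hu i).form_unit z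
  let I : ∀ i, H1 k L (V i) →ₗ[k] H1 k L (⨂[k] i, V i) := fun i =>
    H1.map (insertHom u i fun j _ => (hu j).lie_unit)
  let C : ∀ i, H1 k L (⨂[k] i, V i) →ₗ[k] H1 k L (V i) := fun i =>
    H1.map (contractHom τ i fun j _ => (hu j).form_lie)
  -- the component of a class in the dual of `L / [L, L]` can be computed at any factor
  have htC : ∀ i c, t i (C i c) = t i₀ (C i₀ c) := fun i c => by
    have h1 : ∀ (a : L) (w : ⨂[k] i, V i), (τ i₀ ∘ₗ contractAt τ i₀) ⁅a, w⁆ = 0 := fun a w => by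
      have h2 := (contractHom τ i₀ fun j _ => (hu j).form_lie).map_lie a w
      have h3 : contractAt τ i₀ ⁅a, w⁆ = ⁅a, contractAt τ i₀ w⁆ := h2
      rw [LinearMap.comp_apply, h3, (hu i₀).form_lie]
    exact (H1.toDual_map _ _ _ _ h1 (fun w => form_contractAt τ i i₀ w) c).trans
      (H1.toDual_map _ _ _ _ h1 (fun w => rfl) c).symm
  have hCI : ∀ i c, C i (I i c) = c := fun i c => by
    obtain ⟨D, rfl⟩ := Submodule.mkQ_surjective _ c
    exact congrArg (H1.mk k L) (LieDerivation.ext fun a =>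
      contractAt_insertAt τ u i (fun j hj => (hu j).form_unit) (D a))
  have hCI' : ∀ i j, i ≠ j → ∀ c, C i (I j c) = r i (t j c) := fun i j hij c => by
    obtain ⟨D, rfl⟩ := Submodule.mkQ_surjective _ c
    exact congrArg (H1.mk k L) (LieDerivation.ext fun a =>
      contractAt_insertAt_of_ne τ u hij (fun j => (hu j).form_unit) (D a))
  have huX : ∀ a : L, ⁅a, PiTensorProduct.tprod k u⁆ = 0 := fun a => by
    rw [lie_tprod]
    exact Finset.sum_eq_zero fun j _ => (PiTensorProduct.tprod k).map_coord_zero j (by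
      rw [Function.update_self, (hu j).lie_unit])
  have hIr : ∀ i z, I i (r i z) = H1.ofDual _ huX z := fun i z => by
    obtain h := H1.map_ofDual (insertHom u i fun j _ => (hu j).lie_unit) (u i) (hu i).lie_unit
      (fun a => by
        change ⁅a, insertAt u i (u i)⁆ = 0
        rw [insertAt_self, huX]) z
    refine h.trans ?_
    congr 1
    change H1.ofDual (insertAt u i (u i)) _ = _
    simp only [insertAt_self]
  have hC : ∀ i z, C i (I i₀ (r i₀ z)) = r i z := fun i z => by
    rw [hIr i₀, ← hIr i, hCI]
  -- the decomposition of `id`, rewritten in terms of `I`, `C`, `t` and `r`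
  have key : ∀ c, c = I i₀ (r i₀ (t i₀ (C i₀ c))) + ∑ i, I i (C i c - r i (t i (C i c))) := by
    intro c
    have h := hT.eq_add_sum (fun j => LieModuleHom.id - (hu j).unitProj) (fun j => (hu j).unitProj)
      (fun j => (hu j).isActionProj) (fun j v => sub_add_cancel v _) c
    have hr : ∀ i y, H1.map (hu i).unitProj y = r i (t i y) := fun i y =>
      (H1.ofDual_toDual _ _ _ _ y _ fun _ => rfl).symm
    have hr' : ∀ i y, H1.map (LieModuleHom.id - (hu i).unitProj) y = y - r i (t i y) :=
        fun i y => by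
      rw [eq_sub_iff_add_eq, ← hr, ← H1.map_add, sub_add_cancel, H1.map_id]
    have hterm : ∀ i p, H1.map (tensorHom (Function.update (fun j => (hu j).unitProj) i p)) c =
        I i (H1.map p (C i c)) := fun i p => by
      rw [tensorHom_update_eq u τ i (fun j _ => hu j) _ (fun j _ v => rfl), ← H1.map_map,
        ← H1.map_map]
    rw [Finset.sum_congr rfl fun i _ => (hterm i _).trans (congrArg (I i) (hr' i _))] at h
    have h0 := hterm i₀ (hu i₀).unitProj
    rw [Function.update_eq_self i₀ fun j => (hu j).unitProj, hr] at h0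
    rwa [h0] at h
  let E : H1 k L (⨂[k] i, V i) ≃ₗ[k] Z × ∀ i, LinearMap.ker (t i) :=
    LinearEquiv.ofLinearMap
      ((t i₀ ∘ₗ C i₀).prod (LinearMap.pi fun i =>
        LinearMap.snd k _ _ ∘ₗ (equivProdKer (t i) (r i) (htr i)).toLinearMap ∘ₗ C i))
      ((I i₀ ∘ₗ r i₀).coprod (∑ i, I i ∘ₗ (LinearMap.ker (t i)).subtype ∘ₗ LinearMap.proj i))
      (by
        refine LinearMap.ext fun z => ?_
        have h1 : ∀ i, C i (I i₀ (r i₀ z.1) + ∑ j, I j (z.2 j)) = r i z.1 + z.2 i := fun i => by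
          rw [map_add, map_sum, Finset.sum_eq_single_of_mem i (Finset.mem_univ i), hC, hCI]
          intro j _ hj
          rw [hCI' i j hj.symm, LinearMap.mem_ker.1 (z.2 j).2, map_zero]
        have h2 : ∀ i, t i (r i z.1 + z.2 i) = z.1 := fun i => by
          rw [map_add, htr, LinearMap.mem_ker.1 (z.2 i).2, add_zero]
        rw [LinearMap.comp_apply, LinearMap.coprod_apply, LinearMap.sum_apply]
        refine Prod.ext ((congrArg (t i₀) (h1 i₀)).trans (h2 i₀))
          (funext fun i => Subtype.ext ?_)
        refine (congrArg (fun y => y - r i (t i y)) (h1 i)).trans ?_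
        change r i z.1 + z.2 i - r i (t i (r i z.1 + z.2 i)) = z.2 i
        rw [h2, add_sub_cancel_left])
      (by
        refine LinearMap.ext fun c => ?_
        rw [LinearMap.comp_apply, LinearMap.coprod_apply, LinearMap.sum_apply]
        exact (key c).symm)
  -- `n - 1` copies of `Z` and the one in `E` give one for each factor
  have hcard : Fintype.card ι = Fintype.card (Fin ((Fintype.card ι - 1) + 1)) := by
    rw [Fintype.card_fin, Nat.sub_add_cancel Fintype.card_pos]
  let e : ι ≃ Fin ((Fintype.card ι - 1) + 1) := Fintype.equivOfCardEq hcard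
  let e₁ : ((Fin (Fintype.card ι - 1) → Z) × Z) ≃ₗ[k] (ι → Z) :=
    (LinearEquiv.prodComm k _ _).trans
      ((Fin.consLinearEquiv k fun _ => Z).trans (LinearEquiv.funCongrLeft k Z e))
  let e₂ : ((ι → Z) × ∀ i, LinearMap.ker (t i)) ≃ₗ[k] ∀ i, Z × LinearMap.ker (t i) :=
    { toFun := fun f i => (f.1 i, f.2 i)
      invFun := fun f => (fun i => (f i).1, fun i => (f i).2)
      map_add' := fun _ _ => rfl
      map_smul' := fun _ _ => rfl
      left_inv := fun _ => rfl
      right_inv := fun _ => rfl }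
  exact ⟨((LinearEquiv.refl k _).prodCongr E).trans <|
    (LinearEquiv.prodAssoc k _ _ _).symm.trans <| (e₁.prodCongr (LinearEquiv.refl k _)).trans <|
    e₂.trans <| LinearEquiv.piCongrRight fun i => (equivProdKer (t i) (r i) (htr i)).symm⟩

end Decomposition

/-! ### Linear maps between tensor products -/

section HomTensor

variable {k : Type*} [Field k] {ι : Type*} [Fintype ι] {V : ι → Type*} [∀ i, AddCommGroup (V i)]
  [∀ i, Module k (V i)] {V' : ι → Type*} [∀ i, AddCommGroup (V' i)] [∀ i, Module k (V' i)]

theorem piTensorHomMap_bijective [∀ i, FiniteDimensional k (V i)]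
    [∀ i, FiniteDimensional k (V' i)] : Function.Bijective
      (PiTensorProduct.piTensorHomMap : (⨂[k] i, V i →ₗ[k] V' i) →ₗ[k] _ →ₗ[k] ⨂[k] i, V' i) := by
  classical
  let b := fun i => Module.finBasis k (V i)
  let b' := fun i => Module.finBasis k (V' i)
  let B := Basis.piTensorProduct fun i => (b i).linearMap (b' i)
  let B' := (Basis.piTensorProduct b).linearMap (Basis.piTensorProduct b')
  let e := Equiv.arrowProdEquivProdArrow ι (fun i => Fin (Module.finrank k (V' i)))
    (fun i => Fin (Module.finrank k (V i)))
  suffices h : PiTensorProduct.piTensorHomMap = (B.equiv B' e).toLinearMap from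
    h ▸ (B.equiv B' e).bijective
  refine B.ext fun p => (Basis.piTensorProduct b).ext fun q => ?_
  rw [LinearEquiv.coe_coe, Module.Basis.equiv_apply, Basis.piTensorProduct_apply,
    Basis.piTensorProduct_apply, PiTensorProduct.piTensorHomMap_tprod_tprod,
    ← Basis.piTensorProduct_apply b, Module.Basis.linearMap_apply_apply]
  simp only [Module.Basis.linearMap_apply_apply]
  split_ifs with h
  · rw [Basis.piTensorProduct_apply]
    congr 1
    funext i
    exact if_pos (congrFun h i)
  · obtain ⟨i, hi⟩ := Function.ne_iff.1 h
    exact (PiTensorProduct.tprod k).map_coord_zero i (if_neg hi)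

variable {L : Type*} [LieRing L] [LieAlgebra k L] [∀ i, LieRingModule L (V i)]
  [∀ i, LieModule k L (V i)] [∀ i, LieRingModule L (V' i)] [∀ i, LieModule k L (V' i)]

theorem piTensorHomMap_lie (l : L) (t : ⨂[k] i, V i →ₗ[k] V' i) :
    PiTensorProduct.piTensorHomMap ⁅l, t⁆ = ⁅l, PiTensorProduct.piTensorHomMap t⁆ := by
  classical
  suffices h : PiTensorProduct.piTensorHomMap ∘ₗ tensorAct (fun i => V i →ₗ[k] V' i) l =
      LieModule.toEnd k L ((⨂[k] i, V i) →ₗ[k] ⨂[k] i, V' i) l ∘ₗ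
        PiTensorProduct.piTensorHomMap from LinearMap.congr_fun h t
  refine PiTensorProduct.ext (MultilinearMap.ext fun f =>
    PiTensorProduct.ext (MultilinearMap.ext fun v => ?_))
  change PiTensorProduct.piTensorHomMap ⁅l, PiTensorProduct.tprod k f⁆ (PiTensorProduct.tprod k v) =
    ⁅l, PiTensorProduct.piTensorHomMap (PiTensorProduct.tprod k f) (PiTensorProduct.tprod k v)⁆ -
      PiTensorProduct.piTensorHomMap (PiTensorProduct.tprod k f) ⁅l, PiTensorProduct.tprod k v⁆
  rw [lie_tprod, lie_tprod, PiTensorProduct.piTensorHomMap_tprod_tprod, lie_tprod, map_sum,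
    map_sum, LinearMap.sum_apply, ← Finset.sum_sub_distrib]
  refine Finset.sum_congr rfl fun i _ => ?_
  rw [PiTensorProduct.piTensorHomMap_tprod_tprod, PiTensorProduct.piTensorHomMap_tprod_tprod]
  have h1 : (fun j => Function.update f i ⁅l, f i⁆ j (v j)) =
      Function.update (fun j => f j (v j)) i (⁅l, f i (v i)⁆ - f i ⁅l, v i⁆) := by
    funext j
    by_cases h : j = i
    · subst h; simp
    · simp [Function.update_of_ne h]
  have h2 : (fun j => f j (Function.update v i ⁅l, v i⁆ j)) =
      Function.update (fun j => f j (v j)) i (f i ⁅l, v i⁆) := by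
    funext j
    by_cases h : j = i
    · subst h; simp
    · simp [Function.update_of_ne h]
  rw [h1, h2, MultilinearMap.map_update_sub]

/-- `⨂ Hom(V i, V' i) ≃ Hom(⨂ V i, ⨂ V' i)` for finite-dimensional modules. -/
def tensorHomEquiv [∀ i, FiniteDimensional k (V i)] [∀ i, FiniteDimensional k (V' i)] :
    (⨂[k] i, V i →ₗ[k] V' i) ≃ₗ⁅k,L⁆ ((⨂[k] i, V i) →ₗ[k] ⨂[k] i, V' i) :=
  { LinearEquiv.ofBijective PiTensorProduct.piTensorHomMap piTensorHomMap_bijective with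
    map_lie' := fun {l t} => piTensorHomMap_lie l t }

end HomTensor

/-! ### Schur's lemma and the normalised trace form -/

section Schur

variable {k : Type*} {L : Type*} [Field k] [LieRing L] [LieAlgebra k L]
  {V : Type*} [AddCommGroup V] [Module k V] [LieRingModule L V] [LieModule k L V]
  {V' : Type*} [AddCommGroup V'] [Module k V'] [LieRingModule L V'] [LieModule k L V']

/-- The homomorphism of modules given by an invariant vector of `Hom(V, V')`. -/
def homOfInvariant (f : V →ₗ[k] V') (hf : ∀ l : L, ⁅l, f⁆ = 0) : V →ₗ⁅k,L⁆ V' :=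
  { f with
    map_lie' := fun {l v} => by
      have h : ⁅l, f v⁆ - f ⁅l, v⁆ = 0 := LinearMap.congr_fun (hf l) v
      exact (sub_eq_zero.1 h).symm }

omit [LieAlgebra k L] [LieModule k L V] [LieModule k L V'] in
/-- A nonzero homomorphism between irreducible modules gives an isomorphism. -/
theorem nonempty_equiv_of_ne_zero [LieModule.IsIrreducible k L V] [LieModule.IsIrreducible k L V']
    (f : V →ₗ⁅k,L⁆ V') (hf : f ≠ 0) : Nonempty (V ≃ₗ⁅k,L⁆ V') := by
  have hker : f.ker = ⊥ := by
    refine (eq_bot_or_eq_top f.ker).resolve_right fun h => hf (LieModuleHom.ext fun v => ?_)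
    exact LieModuleHom.mem_ker.1 (h ▸ LieSubmodule.mem_top v)
  have hrange : f.range = ⊤ := by
    refine (eq_bot_or_eq_top f.range).resolve_left fun h => hf (LieModuleHom.ext fun v => ?_)
    have := (LieModuleHom.mem_range f (f v)).2 ⟨v, rfl⟩
    rw [h, LieSubmodule.mem_bot] at this
    exact this
  have hinj : Function.Injective f := by
    refine (injective_iff_map_eq_zero f).2 fun v hv => ?_
    have := (LieModuleHom.mem_ker (f := f)).2 hv
    rwa [hker, LieSubmodule.mem_bot] at this
  have hsurj : Function.Surjective f := fun v => by
    have := LieSubmodule.mem_top (R := k) (L := L) v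
    rwa [← hrange, LieModuleHom.mem_range] at this
  exact ⟨{ LinearEquiv.ofBijective (f : V →ₗ[k] V') ⟨hinj, hsurj⟩ with
    map_lie' := fun {l v} => f.map_lie l v }⟩

theorem eq_zero_of_invariant [LieModule.IsIrreducible k L V] [LieModule.IsIrreducible k L V']
    (h : IsEmpty (V ≃ₗ⁅k,L⁆ V')) (f : V →ₗ[k] V') (hf : ∀ l : L, ⁅l, f⁆ = 0) : f = 0 := by
  by_contra hne
  obtain ⟨e⟩ := nonempty_equiv_of_ne_zero (homOfInvariant f hf) fun h0 =>
    hne (LinearMap.ext fun v => LieModuleHom.congr_fun h0 v)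
  exact h.elim e

theorem exists_eq_smul_of_invariant [IsAlgClosed k] [FiniteDimensional k V]
    [LieModule.IsIrreducible k L V] (f : V →ₗ[k] V) (hf : ∀ l : L, ⁅l, f⁆ = 0) :
    ∃ c : k, f = c • LinearMap.id := by
  have : Nontrivial V := (LieSubmodule.nontrivial_iff k L V).1 inferInstance
  obtain ⟨c, hc⟩ := Module.End.exists_eigenvalue f
  let g := homOfInvariant (L := L) (f - c • LinearMap.id) fun l => by
    rw [lie_sub, hf, lie_smul, zero_sub, neg_eq_zero]
    convert smul_zero c
    ext v
    simp
  have hg : g.ker = ⊤ := by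
    refine (eq_bot_or_eq_top g.ker).resolve_left fun h => ?_
    obtain ⟨v, hv, hv0⟩ := hc.exists_hasEigenvector
    refine hv0 ((LieSubmodule.mem_bot (R := k) (L := L) v).1 (h ▸ LieModuleHom.mem_ker.2 ?_))
    change f v - c • v = 0
    rw [Module.End.mem_eigenspace_iff.1 hv, sub_self]
  refine ⟨c, LinearMap.ext fun v => ?_⟩
  have : g v = 0 := LieModuleHom.mem_ker.1 (hg ▸ LieSubmodule.mem_top v)
  exact sub_eq_zero.1 this

/-- The linear form `f ↦ tr(e⁻¹ ∘ f) / dim V` on `Hom(V, V')` attached to an isomorphism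
`e : V ≃ V'`. -/
def traceForm (e : V ≃ₗ⁅k,L⁆ V') : Module.Dual k (V →ₗ[k] V') :=
  (Module.finrank k V : k)⁻¹ • (LinearMap.trace k V ∘ₗ
    LinearMap.compRight k (e.symm.toLinearEquiv : V' →ₗ[k] V))

omit [LieAlgebra k L] [LieModule k L V] [LieModule k L V'] in
theorem traceForm_apply (e : V ≃ₗ⁅k,L⁆ V') (f : V →ₗ[k] V') :
    traceForm e f = (Module.finrank k V : k)⁻¹ *
      LinearMap.trace k V ((e.symm.toLinearEquiv : V' →ₗ[k] V) ∘ₗ f) := rfl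

/-- The invariants of `Hom(V, V')` for isomorphic irreducible modules are spanned by an isomorphism,
and the trace form provides an invariant complement. -/
theorem isSplitUnit_of_equiv [IsAlgClosed k] [CharZero k] [FiniteDimensional k V]
    [LieModule.IsIrreducible k L V] (e : V ≃ₗ⁅k,L⁆ V') :
    IsSplitUnit (L := L) (e.toLinearEquiv : V →ₗ[k] V') (traceForm e) := by
  have : Nontrivial V := (LieSubmodule.nontrivial_iff k L V).1 inferInstance
  have hn : (Module.finrank k V : k) ≠ 0 := Nat.cast_ne_zero.2 Module.finrank_pos.ne'
  have hsymm : ∀ (l : L) (v : V'), e.symm ⁅l, v⁆ = ⁅l, e.symm v⁆ := fun l v =>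
    e.symm.toLieModuleHom.map_lie l v
  have hunit : traceForm e (e.toLinearEquiv : V →ₗ[k] V') = 1 := by
    rw [traceForm_apply]
    have : (e.symm.toLinearEquiv : V' →ₗ[k] V) ∘ₗ (e.toLinearEquiv : V →ₗ[k] V') = LinearMap.id :=
      LinearMap.ext fun v => e.symm_apply_apply v
    rw [this, LinearMap.trace_id, inv_mul_cancel₀ hn]
  refine ⟨fun l => LinearMap.ext fun v => ?_, fun l f => ?_, hunit, fun f hf => ?_⟩
  · change ⁅l, e v⁆ - e ⁅l, v⁆ = 0
    rw [sub_eq_zero]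
    exact (e.toLieModuleHom.map_lie l v).symm
  · let g : Module.End k V := (e.symm.toLinearEquiv : V' →ₗ[k] V) ∘ₗ f
    have h : (e.symm.toLinearEquiv : V' →ₗ[k] V) ∘ₗ ⁅l, f⁆ =
        LieModule.toEnd k L V l * g - g * LieModule.toEnd k L V l := LinearMap.ext fun v => by
      change e.symm (⁅l, f v⁆ - f ⁅l, v⁆) = ⁅l, e.symm (f v)⁆ - e.symm (f ⁅l, v⁆)
      rw [map_sub, hsymm]
    rw [traceForm_apply, h, map_sub, LinearMap.trace_mul_comm, sub_self, mul_zero]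
  · obtain ⟨c, hc⟩ := exists_eq_smul_of_invariant (L := L)
      ((e.symm.toLinearEquiv : V' →ₗ[k] V) ∘ₗ f) fun l => LinearMap.ext fun v => by
        have h : ⁅l, f v⁆ - f ⁅l, v⁆ = 0 := LinearMap.congr_fun (hf l) v
        change ⁅l, e.symm (f v)⁆ - e.symm (f ⁅l, v⁆) = 0
        rw [← hsymm, ← map_sub, h, map_zero]
    have hf' : f = c • (e.toLinearEquiv : V →ₗ[k] V') := LinearMap.ext fun v => by
      have h : e.symm (f v) = c • v := LinearMap.congr_fun hc v
      have h' := congrArg e h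
      rw [e.apply_symm_apply] at h'
      rw [h']
      exact map_smul e.toLinearEquiv c v
    conv_rhs => rw [hf', map_smul, hunit, smul_eq_mul, mul_one]
    exact hf'

end Schur

/-! ### `Ext¹` as `H¹` -/

section Ext

variable {k : Type u} {L : Type v} [Field k] [LieRing L] [LieAlgebra k L]
variable {V₁ : Type w₁} [AddCommGroup V₁] [Module k V₁] [LieRingModule L V₁] [LieModule k L V₁]
variable {V₂ : Type w₂} [AddCommGroup V₂] [Module k V₂] [LieRingModule L V₂] [LieModule k L V₂]

variable (k L V₁ V₂) in
/-- `Ext¹(V₁, V₂) ≃ H¹(L, Hom(V₁, V₂))` as vector spaces. -/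
def ext1LinearEquiv : Ext1 k L V₁ V₂ ≃ₗ[k] H1 k L (V₁ →ₗ[k] V₂) :=
  (ext1Equiv k L V₁ V₂).linearEquiv k

end Ext

/-! ### Recognising a factor of a tensor product -/

section TensorComparison

variable {k : Type*} {L : Type*} [Field k] [LieRing L] [LieAlgebra k L]
  {ι : Type*} [Fintype ι] {V : ι → Type*} [∀ i, AddCommGroup (V i)]
  [∀ i, Module k (V i)] [∀ i, LieRingModule L (V i)] [∀ i, LieModule k L (V i)]
  {ι' : Type*} [Fintype ι'] {V' : ι' → Type*} [∀ i, AddCommGroup (V' i)]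
  [∀ i, Module k (V' i)] [∀ i, LieRingModule L (V' i)] [∀ i, LieModule k L (V' i)]

theorem ActsOnly.lie_eq {T : L → L} {i : ι} (h : ActsOnly k V T i) (a : L) (t : ⨂[k] i, V i) :
    ⁅T a, t⁆ = factorEnd i (LieModule.toEnd k L (V i) a) t := by
  classical
  rw [lie_eq_sum_factorEnd, Finset.sum_eq_single_of_mem i (Finset.mem_univ i)]
  · congr 2
    exact LinearMap.ext (h.lie_self a)
  · intro j _ hj
    have : LieModule.toEnd k L (V j) (T a) = 0 := LinearMap.ext (h.lie_of_ne j hj a)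
    rw [this, map_zero, LinearMap.zero_apply]

theorem exists_dual_apply_eq_one {M : Type*} [AddCommGroup M] [Module k M] {m : M} (hm : m ≠ 0) :
    ∃ ξ : Module.Dual k M, ξ m = 1 := by
  obtain ⟨ξ, hξ⟩ : ∃ ξ : Module.Dual k M, ξ m ≠ 0 := by
    by_contra! h
    exact hm ((Module.forall_dual_apply_eq_zero_iff k m).1 h)
  exact ⟨(ξ m)⁻¹ • ξ, inv_mul_cancel₀ hξ⟩

omit [Fintype ι] in
theorem exists_forms_eq_one [∀ i, Nontrivial (V i)] :
    ∃ (w : ∀ i, V i) (ξ : ∀ i, Module.Dual k (V i)), ∀ i, ξ i (w i) = 1 := by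
  choose w hw using fun i => exists_ne (0 : V i)
  choose ξ hξ using fun i => exists_dual_apply_eq_one (k := k) (hw i)
  exact ⟨w, ξ, hξ⟩

/-- If `T` acts only on `V i` and by zero on all `V' j`, then an isomorphism `⨂ V ≃ ⨂ V'` forces the
action on `V i` to be zero. -/
theorem ActsOnly.lie_eq_zero_of_equiv [∀ i, Nontrivial (V i)] {T : L → L} {i : ι}
    (h : ActsOnly k V T i) (h' : ∀ j a (v : V' j), ⁅T a, v⁆ = 0)
    (φ : (⨂[k] i, V i) ≃ₗ⁅k,L⁆ ⨂[k] i, V' i) (a : L) (v : V i) : ⁅a, v⁆ = 0 := by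
  obtain ⟨w, ξ, hξ⟩ := exists_forms_eq_one (k := k) (V := V)
  have h1 : ∀ t : ⨂[k] i, V' i, ⁅T a, t⁆ = 0 := fun t => by
    rw [lie_eq_sum_factorEnd]
    refine Finset.sum_eq_zero fun j _ => ?_
    have : LieModule.toEnd k L (V' j) (T a) = 0 := LinearMap.ext (h' j a)
    rw [this, map_zero, LinearMap.zero_apply]
  have h2 : ⁅T a, insertAt (k := k) w i v⁆ = 0 := by
    have h3 := φ.toLieModuleHom.map_lie (T a) (insertAt w i v)
    rw [h1] at h3
    exact (map_eq_zero_iff φ.toLinearEquiv φ.toLinearEquiv.injective).1 h3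
  rw [h.lie_eq, factorEnd_insertAt] at h2
  have h3 := congrArg (contractAt ξ i) h2
  rwa [contractAt_insertAt ξ w i fun j _ => hξ j, map_zero] at h3

/-- If the same `T` acts only on `V i` and only on `V' i'`, then an isomorphism `⨂ V ≃ ⨂ V'` yields
an isomorphism of the irreducible factors at `i'` and `i`. -/
theorem ActsOnly.nonempty_equiv [∀ i, Nontrivial (V i)] {T : L → L} {i : ι} {i' : ι'}
    (h : ActsOnly k V T i) (h' : ActsOnly k V' T i')
    [LieModule.IsIrreducible k L (V i)] [LieModule.IsIrreducible k L (V' i')]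
    (φ : (⨂[k] i, V i) ≃ₗ⁅k,L⁆ ⨂[k] i, V' i) : Nonempty (V' i' ≃ₗ⁅k,L⁆ V i) := by
  classical
  obtain ⟨w, ξ, hξ⟩ := exists_forms_eq_one (k := k) (V := V)
  have hφ : ∀ a t, φ.symm ⁅a, t⁆ = ⁅a, φ.symm t⁆ := φ.symm.toLieModuleHom.map_lie
  let c : (⨂[k] i, V' i) →ₗ[k] V i :=
    contractAt ξ i ∘ₗ (φ.symm.toLinearEquiv : (⨂[k] i, V' i) →ₗ[k] ⨂[k] i, V i)
  have hc : ∀ t, c t = contractAt ξ i (φ.symm t) := fun _ => rfl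
  have hc0 : c ≠ 0 := fun h0 => by
    obtain ⟨v, hv⟩ := exists_ne (0 : V i)
    have h1 := LinearMap.congr_fun h0 (φ (insertAt w i v))
    rw [hc, φ.symm_apply_apply, contractAt_insertAt ξ w i fun j _ => hξ j] at h1
    exact hv h1
  -- some pure tensor is not killed by `c`, so the insertion into it composed with `c` is nonzero
  obtain ⟨v', hv'⟩ : ∃ v', c (PiTensorProduct.tprod k v') ≠ 0 := by
    by_contra! hall
    exact hc0 (PiTensorProduct.ext (MultilinearMap.ext hall))
  let f : V' i' →ₗ⁅k,L⁆ V i :=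
    { c ∘ₗ insertAt v' i' with
      map_lie' := fun {a y} => by
        change c (insertAt v' i' ⁅a, y⁆) = ⁅a, c (insertAt v' i' y)⁆
        have h1 := factorEnd_insertAt v' i' (LieModule.toEnd k L (V' i') a) y
        rw [← h'.lie_eq, LieModule.toEnd_apply_apply] at h1
        rw [← h1, hc, hφ, h.lie_eq, contractAt_factorEnd]
        rfl }
  refine nonempty_equiv_of_ne_zero f fun h0 => hv' ?_
  have h1 : c (insertAt v' i' (v' i')) = 0 := LieModuleHom.congr_fun h0 (v' i')
  rwa [insertAt_self] at h1

/-- Two irreducible modules with zero action are isomorphic, being one-dimensional. -/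
theorem nonempty_equiv_of_lie_eq_zero {M M' : Type*} [AddCommGroup M] [Module k M]
    [LieRingModule L M] [LieModule k L M] [AddCommGroup M'] [Module k M'] [LieRingModule L M']
    [LieModule k L M'] [LieModule.IsIrreducible k L M] [LieModule.IsIrreducible k L M']
    (h : ∀ (a : L) (m : M), ⁅a, m⁆ = 0) (h' : ∀ (a : L) (m : M'), ⁅a, m⁆ = 0) :
    Nonempty (M ≃ₗ⁅k,L⁆ M') := by
  have : Nontrivial M := (LieSubmodule.nontrivial_iff k L M).1 inferInstance
  have : Nontrivial M' := (LieSubmodule.nontrivial_iff k L M').1 inferInstance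
  obtain ⟨m, hm⟩ := exists_ne (0 : M)
  obtain ⟨m', hm'⟩ := exists_ne (0 : M')
  obtain ⟨ξ, hξ⟩ := exists_dual_apply_eq_one (k := k) hm
  let f : M →ₗ⁅k,L⁆ M' :=
    { ξ.smulRight m' with
      map_lie' := fun {a x} => by
        change ξ ⁅a, x⁆ • m' = ⁅a, ξ x • m'⁆
        rw [h, h', map_zero, zero_smul] }
  refine nonempty_equiv_of_ne_zero f fun h0 => hm' ?_
  have h1 : ξ m • m' = 0 := LieModuleHom.congr_fun h0 m
  rwa [hξ, one_smul] at h1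

end TensorComparison

/-! ### Invariant functions and evaluation of equivariant maps -/

section Points

variable {k : Type*} {A : Type*} {g : Type*} {Γ : Type*} [Field k]
  [CommRing A] [Algebra k A] [LieRing g] [LieAlgebra k g] [Group Γ]
  [MulSemiringAction Γ A] [SMulCommClass Γ k A]
  [DistribMulAction Γ g] [SMulCommClass Γ k g] [LieAutAction Γ g]

theorem RatPoint.smul_toAlgHom (γ : Γ) (x : RatPoint k A) (a : A) :
    (γ • x).toAlgHom a = x.toAlgHom (γ⁻¹ • a) := rfl

theorem RatPoint.exists_eq_one_eq_zero {x y : RatPoint k A} (h : x ≠ y) :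
    ∃ a : A, x.toAlgHom a = 1 ∧ y.toAlgHom a = 0 := by
  obtain ⟨a, ha⟩ : ∃ a, x.toAlgHom a ≠ y.toAlgHom a := by
    by_contra! h0
    exact h (AlgHom.ext h0)
  refine ⟨algebraMap k A (x.toAlgHom a - y.toAlgHom a)⁻¹ * (a - algebraMap k A (y.toAlgHom a)),
    ?_, ?_⟩
  · rw [map_mul, map_sub, AlgHom.commutes, AlgHom.commutes]
    exact inv_mul_cancel₀ (sub_ne_zero.2 ha)
  · rw [map_mul, map_sub, AlgHom.commutes, AlgHom.commutes]
    exact mul_eq_zero_of_right _ (sub_self _)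

theorem RatPoint.exists_invariant_of_notMem_orbit [Finite Γ] {x y : RatPoint k A}
    (h : y ∉ MulAction.orbit Γ x) :
    ∃ a : A, (∀ γ : Γ, γ • a = a) ∧ x.toAlgHom a = 1 ∧ y.toAlgHom a = 0 := by
  classical
  have := Fintype.ofFinite Γ
  choose b hb using fun γ : Γ => RatPoint.exists_eq_one_eq_zero (x := γ • x) (y := y)
    fun e => h ⟨γ, e⟩
  -- `f` is `1` on the orbit of `x` and `0` at `y`; its norm is invariant and has the same values
  -- at `x` and `y`
  let f : A := 1 - ∏ γ : Γ, (1 - b γ)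
  have hfx : ∀ γ : Γ, (γ • x).toAlgHom f = 1 := fun γ => by
    rw [map_sub, map_prod, map_one, Finset.prod_eq_zero (Finset.mem_univ γ), sub_zero]
    rw [map_sub, map_one, (hb γ).1, sub_self]
  have hfy : y.toAlgHom f = 0 := by
    rw [map_sub, map_prod, map_one, Finset.prod_eq_one, sub_self]
    intro γ _
    rw [map_sub, map_one, (hb γ).2, sub_zero]
  refine ⟨∏ δ : Γ, δ • f, fun γ => ?_, ?_, ?_⟩
  · rw [Finset.smul_prod']
    simp only [smul_smul]
    exact Fintype.prod_equiv (Equiv.mulLeft γ) _ _ fun δ => rfl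
  · rw [map_prod]
    refine Finset.prod_eq_one fun δ _ => ?_
    have := hfx δ⁻¹
    rwa [RatPoint.smul_toAlgHom, inv_inv] at this
  · rw [map_prod]
    exact Finset.prod_eq_zero (Finset.mem_univ 1) (by rw [one_smul, hfy])

theorem RatPoint.exists_invariant_of_forall_notMem_orbit [Finite Γ] (x : RatPoint k A)
    (s : Finset (RatPoint k A)) :
    ∃ a : A, (∀ γ : Γ, γ • a = a) ∧ x.toAlgHom a = 1 ∧
      ∀ y ∈ s, y ∉ MulAction.orbit Γ x → y.toAlgHom a = 0 := by
  classical
  choose! b hb using fun (y : RatPoint k A) (h : y ∉ MulAction.orbit Γ x) =>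
    RatPoint.exists_invariant_of_notMem_orbit h
  refine ⟨∏ y ∈ s with y ∉ MulAction.orbit Γ x, b y, fun γ => ?_, ?_, fun y hy hyx => ?_⟩
  · rw [Finset.smul_prod']
    exact Finset.prod_congr rfl fun y hy => (hb y (Finset.mem_filter.1 hy).2).1 γ
  · rw [map_prod]
    exact Finset.prod_eq_one fun y hy => (hb y (Finset.mem_filter.1 hy).2).2.1
  · rw [map_prod]
    exact Finset.prod_eq_zero (Finset.mem_filter.2 ⟨hy, hyx⟩) (hb y hyx).2.2

theorem evalLin_smul_left (x : RatPoint k A) (a : A) (α : A ⊗[k] g) :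
    evalLin k g x (a • α) = x.toAlgHom a • evalLin k g x α := by
  induction α with
  | zero => rw [smul_zero, map_zero, smul_zero]
  | add α β hα hβ => rw [smul_add, map_add, map_add, smul_add, hα, hβ]
  | tmul b u =>
    rw [TensorProduct.smul_tmul', evalLin_tmul, evalLin_tmul, smul_eq_mul, map_mul, smul_smul]

theorem diagHom_tmul (γ : Γ) (a : A) (u : g) : diagHom k A g γ (a ⊗ₜ u) = (γ • a) ⊗ₜ (γ • u) := rfl

theorem diagHom_smul (γ : Γ) (a : A) (α : A ⊗[k] g) :
    diagHom k A g γ (a • α) = (γ • a) • diagHom k A g γ α := by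
  induction α with
  | zero => rw [smul_zero, map_zero, smul_zero]
  | add α β hα hβ => rw [smul_add, map_add, map_add, smul_add, hα, hβ]
  | tmul b u =>
    rw [TensorProduct.smul_tmul', diagHom_tmul, diagHom_tmul, TensorProduct.smul_tmul', smul_eq_mul,
      smul_eq_mul, smul_mul']

variable (k g) in
/-- Multiplication of equivariant maps by an invariant function. -/
def mulInvariant (a : A) (ha : ∀ γ : Γ, γ • a = a) :
    mapAlgebra k A g Γ →ₗ[k] mapAlgebra k A g Γ where
  toFun α := ⟨a • (α : A ⊗[k] g), fun γ => by rw [diagHom_smul, ha, α.2 γ]⟩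
  map_add' α β := Subtype.ext (smul_add a (α : A ⊗[k] g) β)
  map_smul' c α := Subtype.ext (smul_comm a c (α : A ⊗[k] g))

theorem mulInvariant_lie (a : A) (ha : ∀ γ : Γ, γ • a = a) (α β : mapAlgebra k A g Γ) :
    mulInvariant k g a ha ⁅α, β⁆ = ⁅mulInvariant k g a ha α, β⁆ :=
  Subtype.ext (smul_lie a (α : A ⊗[k] g) (β : A ⊗[k] g)).symm

theorem evalHom_mulInvariant (x : RatPoint k A) (a : A) (ha : ∀ γ : Γ, γ • a = a)
    (α : mapAlgebra k A g Γ) :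
    evalHom k g Γ x (mulInvariant k g a ha α) = x.toAlgHom a • evalHom k g Γ x α :=
  Subtype.ext (evalLin_smul_left x a (α : A ⊗[k] g))

theorem isotropyConj_evalHom (γ : Γ) (x : RatPoint k A) (α : mapAlgebra k A g Γ) :
    isotropyConj k g γ x (evalHom k g Γ (γ • x) α) = evalHom k g Γ x α := by
  have h := evalLin_smul k g x γ (α : A ⊗[k] g)
  rw [α.2 γ] at h
  exact Subtype.ext (inv_smul_eq_iff.2 h)

theorem evalHom_surjective [CharZero k] [Finite Γ] (x : RatPoint k A) :
    Function.Surjective (evalHom k g Γ x) := by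
  classical
  have := Fintype.ofFinite Γ
  intro u
  choose! b hb using fun (γ : Γ) (h : x ≠ γ • x) => RatPoint.exists_eq_one_eq_zero h
  -- the sum over `Γ` of the translates of `f ⊗ u`, with `f` equal to `1` at `x` and to `0` at the
  -- rest of the orbit, takes the value `n u` at `x`, where `n` is the order of the isotropy group
  let f : A := ∏ γ : Γ with x ≠ γ • x, b γ
  have hf1 : x.toAlgHom f = 1 := by
    rw [map_prod]
    exact Finset.prod_eq_one fun γ hγ => (hb γ (Finset.mem_filter.1 hγ).2).1
  have hf0 : ∀ γ : Γ, x ≠ γ • x → (γ • x).toAlgHom f = 0 := fun γ hγ => by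
    rw [map_prod]
    exact Finset.prod_eq_zero (Finset.mem_filter.2 ⟨Finset.mem_univ γ, hγ⟩) (hb γ hγ).2
  let n : ℕ := (Finset.univ.filter fun γ : Γ => x = γ⁻¹ • x).card
  have hn : (n : k) ≠ 0 := Nat.cast_ne_zero.2 (Finset.card_pos.2
    ⟨1, Finset.mem_filter.2 ⟨Finset.mem_univ _, by rw [inv_one, one_smul]⟩⟩).ne'
  let α : A ⊗[k] g := ∑ γ : Γ, diagHom k A g γ (f ⊗ₜ (u : g))
  have hα : ∀ δ : Γ, diagHom k A g δ α = α := fun δ => by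
    rw [map_sum]
    simp only [diagHom_tmul, smul_smul]
    exact Fintype.sum_equiv (Equiv.mulLeft δ) _ _ fun γ => rfl
  have hev : evalLin k g x α = (n : k) • (u : g) := by
    have h1 : ∀ γ : Γ, evalLin k g x (diagHom k A g γ (f ⊗ₜ (u : g))) =
        if x = γ⁻¹ • x then (u : g) else 0 := fun γ => by
      have h2 : x.toAlgHom (γ • f) = (γ⁻¹ • x).toAlgHom f := by
        rw [RatPoint.smul_toAlgHom, inv_inv]
      rw [diagHom_tmul, evalLin_tmul, h2]
      split_ifs with h
      · rw [← h, hf1, one_smul]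
        refine u.2 γ (MulAction.mem_stabilizer_iff.2 ?_)
        rw [smul_eq_iff_eq_inv_smul]
        exact h
      · rw [hf0 _ h, zero_smul]
    rw [map_sum, Finset.sum_congr rfl fun γ _ => h1 γ, ← Finset.sum_filter, Finset.sum_const,
      Nat.cast_smul_eq_nsmul]
  refine ⟨⟨(n : k)⁻¹ • α, fun δ => by rw [map_smul, hα]⟩, Subtype.ext ?_⟩
  change evalLin k g x ((n : k)⁻¹ • α) = u
  rw [map_smul, hev, smul_smul, inv_mul_cancel₀ hn, one_smul]

end Points

/-! ### Evaluation modules -/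

section EvalModules

variable {k : Type u} {A : Type v} {g : Type w} {Γ : Type w₁} [Field k]
  [CommRing A] [Algebra k A] [LieRing g] [LieAlgebra k g] [Group Γ]
  [MulSemiringAction Γ A] [SMulCommClass Γ k A]
  [DistribMulAction Γ g] [SMulCommClass Γ k g] [LieAutAction Γ g]

section

variable (x : RatPoint k A) {W : Type*} [AddCommGroup W] [Module k W]
  [LieRingModule (isotropy k g Γ x) W] [LieModule k (isotropy k g Γ x) W]
  {W' : Type*} [AddCommGroup W'] [Module k W']
  [LieRingModule (isotropy k g Γ x) W'] [LieModule k (isotropy k g Γ x) W']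

instance [FiniteDimensional k W] : FiniteDimensional k (EvalAt x W) :=
  inferInstanceAs (FiniteDimensional k W)

/-- An isomorphism of `g^x`-modules as an isomorphism of evaluation modules. -/
def evalAtCongr (e : W ≃ₗ⁅k, isotropy k g Γ x⁆ W') :
    EvalAt x W ≃ₗ⁅k, mapAlgebra k A g Γ⁆ EvalAt x W' :=
  { (show EvalAt x W ≃ₗ[k] EvalAt x W' from e.toLinearEquiv) with
    map_lie' := fun {α w} => e.toLieModuleHom.map_lie (evalHom k g Γ x α) w }

variable [CharZero k] [Finite Γ]

omit [LieModule k (isotropy k g Γ x) W] [LieModule k (isotropy k g Γ x) W'] in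
theorem nonempty_equiv_of_evalAt
    (e : EvalAt x W ≃ₗ⁅k, mapAlgebra k A g Γ⁆ EvalAt x W') :
    Nonempty (W ≃ₗ⁅k, isotropy k g Γ x⁆ W') :=
  ⟨{ (show W ≃ₗ[k] W' from e.toLinearEquiv) with
    map_lie' := fun {u w} => by
      obtain ⟨α, rfl⟩ := evalHom_surjective x u
      exact e.toLieModuleHom.map_lie α w }⟩

instance evalAt_isIrreducible [LieModule.IsIrreducible k (isotropy k g Γ x) W] :
    LieModule.IsIrreducible k (mapAlgebra k A g Γ) (EvalAt x W) := by
  have : Nontrivial W := (LieSubmodule.nontrivial_iff k (isotropy k g Γ x) W).1 inferInstance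
  have : Nontrivial (EvalAt x W) := this
  refine LieModule.IsIrreducible.mk fun N hN => ?_
  let N' : LieSubmodule k (isotropy k g Γ x) W :=
    { (N : Submodule k (EvalAt x W)) with
      lie_mem := fun {u m} hm => by
        obtain ⟨α, rfl⟩ := evalHom_surjective x u
        exact N.lie_mem (x := α) hm }
  have e : (show Submodule k (EvalAt x W) from (N' : Submodule k W)) = N := rfl
  rw [← LieSubmodule.toSubmodule_eq_top]
  have h : N' = ⊤ := (eq_bot_or_eq_top N').resolve_left fun h0 => hN (by
    rw [← LieSubmodule.toSubmodule_eq_bot]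
    exact e.symm.trans (by rw [h0, LieSubmodule.bot_toSubmodule]; rfl))
  exact e.symm.trans (by rw [h, LieSubmodule.top_toSubmodule]; rfl)

end

theorem nontrivial_evalAt (x : RatPoint k A) (W : Type*) [AddCommGroup W] [Module k W]
    [LieRingModule (isotropy k g Γ x) W] [LieModule.IsIrreducible k (isotropy k g Γ x) W] :
    Nontrivial (EvalAt x W) :=
  (LieSubmodule.nontrivial_iff k (isotropy k g Γ x) W).1 inferInstance

theorem lie_mulInvariant_evalAt (x : RatPoint k A) {W : Type*} [AddCommGroup W] [Module k W]
    [LieRingModule (isotropy k g Γ x) W] [LieModule k (isotropy k g Γ x) W]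
    {a : A} (ha : ∀ γ : Γ, γ • a = a) (α : mapAlgebra k A g Γ) (w : EvalAt x W) :
    ⁅mulInvariant k g a ha α, w⁆ = x.toAlgHom a • ⁅α, w⁆ := by
  have h := congrArg (fun u => (⁅u, (show W from w)⁆ : W)) (evalHom_mulInvariant (g := g) x a ha α)
  exact h.trans (smul_lie _ (evalHom k g Γ x α) (show W from w))

theorem actsOnly_mulInvariant (s : Finset (RatPoint k A)) (V : s → Type*)
    [∀ x, AddCommGroup (V x)] [∀ x, Module k (V x)]
    [∀ x, LieRingModule (isotropy k g Γ x.1) (V x)]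
    [∀ x, LieModule k (isotropy k g Γ x.1) (V x)]
    {a : A} (ha : ∀ γ : Γ, γ • a = a) (x : s) (h1 : x.1.toAlgHom a = 1)
    (h0 : ∀ y : s, y ≠ x → y.1.toAlgHom a = 0) :
    ActsOnly k (fun y : s => EvalAt y.1 (V y)) (mulInvariant k g a ha) x where
  lie_self α v := by rw [lie_mulInvariant_evalAt, h1, one_smul]
  lie_of_ne y hy α v := by rw [lie_mulInvariant_evalAt, h0 y hy, zero_smul]

theorem IsTransversal.notMem_orbit {s : Finset (RatPoint k A)} (hs : IsTransversal Γ s)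
    {x y : s} (h : y ≠ x) : y.1 ∉ MulAction.orbit Γ x.1 := fun hy =>
  Set.disjoint_left.1 (hs y.1 y.2 x.1 x.2 fun e => h (Subtype.ext e))
    (MulAction.mem_orbit_self y.1) hy

theorem RatPoint.toAlgHom_smul_of_invariant {a : A} (ha : ∀ γ : Γ, γ • a = a) (γ : Γ)
    (x : RatPoint k A) : (γ • x).toAlgHom a = x.toAlgHom a := by
  rw [RatPoint.smul_toAlgHom, ha]

/-- Multiplication by suitable invariant functions separates the modules `Hom(V x, V' x)`. -/
theorem exists_isSeparating [Finite Γ] {s : Finset (RatPoint k A)} (hs : IsTransversal Γ s)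
    (V V' : s → Type*)
    [∀ x, AddCommGroup (V x)] [∀ x, Module k (V x)]
    [∀ x, LieRingModule (isotropy k g Γ x.1) (V x)]
    [∀ x, LieModule k (isotropy k g Γ x.1) (V x)]
    [∀ x, AddCommGroup (V' x)] [∀ x, Module k (V' x)]
    [∀ x, LieRingModule (isotropy k g Γ x.1) (V' x)]
    [∀ x, LieModule k (isotropy k g Γ x.1) (V' x)] :
    ∃ T : s → mapAlgebra k A g Γ →ₗ[k] mapAlgebra k A g Γ,
      IsSeparating k (fun x : s => EvalAt x.1 (V x) →ₗ[k] EvalAt x.1 (V' x)) T := by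
  choose a ha h1 h0 using fun x : s =>
    RatPoint.exists_invariant_of_forall_notMem_orbit (Γ := Γ) x.1 s
  have h0' : ∀ x y : s, y ≠ x → y.1.toAlgHom (a x) = 0 := fun x y hy =>
    h0 x y.1 y.2 (hs.notMem_orbit hy)
  refine ⟨fun x => mulInvariant k g (a x) (ha x), fun x α β => mulInvariant_lie _ _ α β,
    fun x => ⟨fun α f => LinearMap.ext fun v => ?_, fun y hy α f => LinearMap.ext fun v => ?_⟩⟩
  · rw [LieHom.lie_apply, LieHom.lie_apply, lie_mulInvariant_evalAt, lie_mulInvariant_evalAt, h1,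
      one_smul, one_smul]
  · rw [LieHom.lie_apply, lie_mulInvariant_evalAt, lie_mulInvariant_evalAt, h0' x y hy, zero_smul,
      zero_smul, map_zero, sub_zero, LinearMap.zero_apply]

theorem mk_eq_trivial {L : Type*} [LieRing L] [LieAlgebra k L] (ρ : Irrep k L)
    (h : ∀ (a : L) (m : ρ.carrier), ⁅a, m⁆ = 0) :
    (Quotient.mk _ ρ : IrrepClass k L) = IrrepClass.trivial k L :=
  Quotient.sound (nonempty_equiv_of_lie_eq_zero h fun _ _ => rfl)

theorem lie_eq_zero_of_mk_eq_trivial {L : Type*} [LieRing L] [LieAlgebra k L] (ρ : Irrep k L)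
    (h : (Quotient.mk _ ρ : IrrepClass k L) = IrrepClass.trivial k L) (a : L) (m : ρ.carrier) :
    ⁅a, m⁆ = 0 := by
  obtain ⟨e⟩ : Nonempty (ρ.carrier ≃ₗ⁅k,L⁆ (Irrep.trivial k L).carrier) := Quotient.exact h
  have h1 : e ⁅a, m⁆ = ⁅a, e m⁆ := e.toLieModuleHom.map_lie a m
  exact (map_eq_zero_iff e.toLinearEquiv e.toLinearEquiv.injective).1 h1

section Corresponds

variable [CharZero k] [Finite Γ] {s : Finset (RatPoint k A)}
  {V : s → Type w₂}
  [∀ x, AddCommGroup (V x)] [∀ x, Module k (V x)]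
  [∀ x, LieRingModule (isotropy k g Γ x.1) (V x)]
  [∀ x, LieModule k (isotropy k g Γ x.1) (V x)]
  [∀ x, LieModule.IsIrreducible k (isotropy k g Γ x.1) (V x)]
  {ψ : EvalParam k A g Γ}

/-- If the tensor product of the `V x` corresponds to `ψ`, then `ψ x` is the class of `V x`. -/
theorem EvalParam.Corresponds.nonempty_equiv (hs : IsTransversal Γ s)
    (hV : ψ.Corresponds (EvalTensor s V)) (x : s)
    (ρ : Irrep k (isotropy k g Γ x.1)) (hρ : ψ.toFun x.1 = Quotient.mk _ ρ) :
    Nonempty (EvalAt x.1 (V x) ≃ₗ⁅k, mapAlgebra k A g Γ⁆ EvalAt x.1 ρ.carrier) := by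
  classical
  obtain ⟨s', σ, hs', hsub, hcov, hσ, ⟨φ⟩⟩ := hV
  obtain ⟨a, ha, ha1, ha0⟩ :=
    RatPoint.exists_invariant_of_forall_notMem_orbit (Γ := Γ) x.1 (s ∪ s')
  have : ∀ y : s, Nontrivial (EvalAt y.1 (V y)) := fun y =>
    nontrivial_evalAt (g := g) (Γ := Γ) y.1 (V y)
  have hA := actsOnly_mulInvariant (g := g) s V ha x ha1 fun y hy =>
    ha0 y.1 (Finset.mem_union_left _ y.2) (hs.notMem_orbit hy)
  by_cases hx : x.1 ∈ ψ.support
  -- the set used for `ψ` contains a point `γ • x` of the orbit of `x`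
  · obtain ⟨y, hy, γ, rfl⟩ := hcov x.1 hx
    have hB := actsOnly_mulInvariant (g := g) s' (fun y => (σ y).carrier) ha ⟨γ • x.1, hy⟩
      ((RatPoint.toAlgHom_smul_of_invariant ha γ x.1).trans ha1) fun z hz =>
      ha0 z.1 (Finset.mem_union_right _ z.2) fun hzx => by
        have := hs'.notMem_orbit hz
        rw [MulAction.orbit_smul] at this
        exact this hzx
    obtain ⟨e₁⟩ := hA.nonempty_equiv hB φ
    have h1 := (ψ.equivariant γ x.1).symm.trans (hσ ⟨γ • x.1, hy⟩)
    rw [hρ] at h1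
    obtain ⟨e₂⟩ : Nonempty ((ρ.comap (isotropyConj k g γ x.1)
      (isotropyConj_surjective k g γ x.1)).carrier ≃ₗ⁅k, isotropy k g Γ (γ • x.1)⁆
        (σ ⟨γ • x.1, hy⟩).carrier) := Quotient.exact h1
    -- the value at `γ • x` corresponds to the value at `x` under `g^{γ x} ≃ g^x`
    let e₃ : EvalAt x.1 ρ.carrier ≃ₗ⁅k, mapAlgebra k A g Γ⁆
        EvalAt (γ • x.1) (σ ⟨γ • x.1, hy⟩).carrier :=
      { (show EvalAt x.1 ρ.carrier ≃ₗ[k] EvalAt (γ • x.1) (σ ⟨γ • x.1, hy⟩).carrier from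
          e₂.toLinearEquiv) with
        map_lie' := fun {α w} => by
          have h2 := e₂.toLieModuleHom.map_lie (evalHom k g Γ (γ • x.1) α) w
          have h3 : ⁅evalHom k g Γ (γ • x.1) α, (show (ρ.comap (isotropyConj k g γ x.1)
              (isotropyConj_surjective k g γ x.1)).carrier from w)⁆ =
              (⁅isotropyConj k g γ x.1 (evalHom k g Γ (γ • x.1) α), (w : ρ.carrier)⁆ : ρ.carrier) :=
            rfl
          rw [isotropyConj_evalHom] at h3
          exact (congrArg e₂ h3).symm.trans h2 }
    exact ⟨(e₃.trans e₁).symm⟩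
  · have h1 : (Quotient.mk _ ρ : IrrepClass k (isotropy k g Γ x.1)) = IrrepClass.trivial k _ :=
      hρ.symm.trans (not_not.1 hx)
    have hB : ∀ (y : s') α (v : EvalAt y.1 (σ y).carrier),
        ⁅mulInvariant k g a ha α, v⁆ = 0 := fun y α v => by
      rw [lie_mulInvariant_evalAt, ha0 y.1 (Finset.mem_union_right _ y.2), zero_smul]
      rintro ⟨γ, hγ⟩
      have hγ' : γ • x.1 = y.1 := hγ
      have h2 : γ • x.1 ∈ ψ.support := hγ' ▸ hsub y.1 y.2
      refine h2 ?_
      rw [ψ.equivariant, hρ]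
      exact mk_eq_trivial (ρ.comap _ _) fun u m => lie_eq_zero_of_mk_eq_trivial ρ h1 _ m
    exact nonempty_equiv_of_lie_eq_zero (hA.lie_eq_zero_of_equiv hB φ) fun α w =>
      lie_eq_zero_of_mk_eq_trivial ρ h1 (evalHom k g Γ x.1 α) w

omit [∀ x, LieModule.IsIrreducible k (isotropy k g Γ x.1) (V x)] in
/-- If the tensor product of the `V x`, `x ∈ s`, corresponds to `ψ`, then `ψ` is trivial off the
orbits of `s`. -/
theorem EvalParam.Corresponds.eq_trivial (hV : ψ.Corresponds (EvalTensor s V)) {x : RatPoint k A}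
    (hx : ∀ y ∈ s, y ∉ MulAction.orbit Γ x) :
    ψ.toFun x = IrrepClass.trivial k (isotropy k g Γ x) := by
  classical
  obtain ⟨s', σ, hs', hsub, hcov, hσ, ⟨φ⟩⟩ := hV
  by_contra hsupp
  obtain ⟨y, hy, hyx⟩ := hcov x hsupp
  obtain ⟨a, ha, ha1, ha0⟩ :=
    RatPoint.exists_invariant_of_forall_notMem_orbit (Γ := Γ) y (s ∪ s')
  have : ∀ y : s', Nontrivial (EvalAt y.1 (σ y).carrier) := fun y =>
    nontrivial_evalAt (g := g) (Γ := Γ) y.1 (σ y).carrier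
  have hA := actsOnly_mulInvariant (g := g) s' (fun y => (σ y).carrier) ha ⟨y, hy⟩ ha1 fun z hz =>
    ha0 z.1 (Finset.mem_union_right _ z.2) (hs'.notMem_orbit hz)
  have hB : ∀ (z : s) α (v : EvalAt z.1 (V z)), ⁅mulInvariant k g a ha α, v⁆ = 0 := fun z α v => by
    rw [lie_mulInvariant_evalAt, ha0 z.1 (Finset.mem_union_left _ z.2), zero_smul]
    rw [MulAction.orbit_eq_iff.2 hyx]
    exact hx z.1 z.2
  refine hsub y hy ((hσ ⟨y, hy⟩).trans (mk_eq_trivial _ fun u m => ?_))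
  obtain ⟨α, rfl⟩ := evalHom_surjective y u
  exact hA.lie_eq_zero_of_equiv hB φ.symm α m

end Corresponds

end EvalModules

/-! ### The points at which two parameters differ -/

section Parameters

variable {k : Type u} {A : Type v} {g : Type w} {Γ : Type w₁} [Field k]
  [CommRing A] [Algebra k A] [LieRing g] [LieAlgebra k g] [Group Γ]
  [MulSemiringAction Γ A] [SMulCommClass Γ k A]
  [DistribMulAction Γ g] [SMulCommClass Γ k g] [LieAutAction Γ g]
  {ψ ψ' : EvalParam k A g Γ}

theorem EvalParam.mem_diffSet_of_smul {γ : Γ} {x : RatPoint k A} (h : γ • x ∈ ψ.diffSet ψ') :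
    x ∈ ψ.diffSet ψ' := fun h0 => h (by rw [ψ.equivariant, ψ'.equivariant, h0])

variable [CharZero k] [Finite Γ] {s : Finset (RatPoint k A)}
  {V V' : s → Type w₂}
  [∀ x, AddCommGroup (V x)] [∀ x, Module k (V x)]
  [∀ x, LieRingModule (isotropy k g Γ x.1) (V x)]
  [∀ x, LieModule k (isotropy k g Γ x.1) (V x)]
  [∀ x, LieModule.IsIrreducible k (isotropy k g Γ x.1) (V x)]
  [∀ x, AddCommGroup (V' x)] [∀ x, Module k (V' x)]
  [∀ x, LieRingModule (isotropy k g Γ x.1) (V' x)]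
  [∀ x, LieModule k (isotropy k g Γ x.1) (V' x)]
  [∀ x, LieModule.IsIrreducible k (isotropy k g Γ x.1) (V' x)]

theorem EvalParam.Corresponds.mem_diffSet_iff (hs : IsTransversal Γ s)
    (hV : ψ.Corresponds (EvalTensor s V)) (hV' : ψ'.Corresponds (EvalTensor s V')) (x : s) :
    x.1 ∈ ψ.diffSet ψ' ↔
      IsEmpty (EvalAt x.1 (V x) ≃ₗ⁅k, mapAlgebra k A g Γ⁆ EvalAt x.1 (V' x)) := by
  obtain ⟨ρ, hρ⟩ := Quotient.exists_rep (ψ.toFun x.1)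
  obtain ⟨ρ', hρ'⟩ := Quotient.exists_rep (ψ'.toFun x.1)
  obtain ⟨e⟩ := hV.nonempty_equiv hs x ρ hρ.symm
  obtain ⟨e'⟩ := hV'.nonempty_equiv hs x ρ' hρ'.symm
  rw [← not_nonempty_iff]
  refine not_congr ⟨fun h => ?_, fun ⟨f⟩ => ?_⟩
  · rw [← hρ, ← hρ'] at h
    obtain ⟨f⟩ : Nonempty (ρ.carrier ≃ₗ⁅k, isotropy k g Γ x.1⁆ ρ'.carrier) := Quotient.exact h
    exact ⟨(e.trans (evalAtCongr x.1 f)).trans e'.symm⟩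
  · rw [← hρ, ← hρ']
    exact Quotient.sound (nonempty_equiv_of_evalAt x.1 ((e.symm.trans f).trans e'))

omit [∀ x, LieModule.IsIrreducible k (isotropy k g Γ x.1) (V x)]
  [∀ x, LieModule.IsIrreducible k (isotropy k g Γ x.1) (V' x)] in
/-- Off the orbits of `s` both parameters are trivial, so that every orbit on which they differ
meets `s`. -/
theorem EvalParam.Corresponds.exists_mem_diffSet
    (hV : ψ.Corresponds (EvalTensor s V)) (hV' : ψ'.Corresponds (EvalTensor s V'))
    {x : RatPoint k A} (hx : x ∈ ψ.diffSet ψ') :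
    ∃ y : s, y.1 ∈ MulAction.orbit Γ x ∧ y.1 ∈ ψ.diffSet ψ' := by
  obtain ⟨y, hy, hyx⟩ : ∃ y ∈ s, y ∈ MulAction.orbit Γ x := by
    by_contra! h
    exact hx ((hV.eq_trivial h).trans (hV'.eq_trivial h).symm)
  refine ⟨⟨y, hy⟩, hyx, ?_⟩
  obtain ⟨γ, hγ⟩ := MulAction.mem_orbit_symm.1 hyx
  exact EvalParam.mem_diffSet_of_smul (γ := γ) (by rwa [show γ • y = x from hγ])

end Parameters

end EMA

end

theorem theorem3p8 {k : Type u} {A : Type v} {g : Type w} {Γ : Type w₁} [Field k] [IsAlgClosed k]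
    [CharZero k] [CommRing A] [Algebra k A] [Algebra.FiniteType k A]
    [LieRing g] [LieAlgebra k g] [FiniteDimensional k g] [LieAlgebra.HasCentralRadical k g]
    [Group Γ] [Finite Γ] [MulSemiringAction Γ A] [SMulCommClass Γ k A]
    [DistribMulAction Γ g] [SMulCommClass Γ k g] [EMA.LieAutAction Γ g]
    (ψ ψ' : EMA.EvalParam k A g Γ)
    (s : Finset (EMA.RatPoint k A)) (hs : EMA.IsTransversal Γ s)
    (V V' : s → Type w₂)
    [∀ x, AddCommGroup (V x)] [∀ x, Module k (V x)]
    [∀ x, LieRingModule (EMA.isotropy k g Γ x.1) (V x)]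
    [∀ x, LieModule k (EMA.isotropy k g Γ x.1) (V x)]
    [∀ x, FiniteDimensional k (V x)]
    [∀ x, LieModule.IsIrreducible k (EMA.isotropy k g Γ x.1) (V x)]
    [∀ x, AddCommGroup (V' x)] [∀ x, Module k (V' x)]
    [∀ x, LieRingModule (EMA.isotropy k g Γ x.1) (V' x)]
    [∀ x, LieModule k (EMA.isotropy k g Γ x.1) (V' x)]
    [∀ x, FiniteDimensional k (V' x)]
    [∀ x, LieModule.IsIrreducible k (EMA.isotropy k g Γ x.1) (V' x)]
    (hV : ψ.Corresponds (EMA.EvalTensor s V))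
    (hV' : ψ'.Corresponds (EMA.EvalTensor s V')) :
    ((∃ x ∈ ψ.diffSet ψ', ∃ y ∈ ψ.diffSet ψ', MulAction.orbit Γ x ≠ MulAction.orbit Γ y) →
      Subsingleton
        (EMA.Ext1 k (EMA.mapAlgebra k A g Γ) (EMA.EvalTensor s V) (EMA.EvalTensor s V'))) ∧
    (∀ x₀ : s, ψ.diffSet ψ' = MulAction.orbit Γ x₀.1 →
      Nonempty
        (EMA.Ext1 k (EMA.mapAlgebra k A g Γ) (EMA.EvalTensor s V) (EMA.EvalTensor s V') ≃ₗ[k]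
          EMA.Ext1 k (EMA.mapAlgebra k A g Γ) (EMA.EvalAt x₀.1 (V x₀))
            (EMA.EvalAt x₀.1 (V' x₀)))) ∧
    (ψ = ψ' →
      Nonempty (EMA.EvalTensor s V ≃ₗ⁅k, EMA.mapAlgebra k A g Γ⁆ EMA.EvalTensor s V') ∧
      (s.Nonempty →
        Nonempty
          (((Fin (s.card - 1) →
                Module.Dual k (EMA.Abelianization k (EMA.mapAlgebra k A g Γ))) ×
              EMA.Ext1 k (EMA.mapAlgebra k A g Γ) (EMA.EvalTensor s V) (EMA.EvalTensor s V)) ≃ₗ[k]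
            ((x : s) → EMA.Ext1 k (EMA.mapAlgebra k A g Γ) (EMA.EvalAt x.1 (V x))
              (EMA.EvalAt x.1 (V x)))))) := by
  classical
  obtain ⟨T, hT⟩ := EMA.exists_isSeparating (g := g) hs V V'
  refine ⟨?_, ?_, ?_⟩
  · rintro ⟨x, hx, y, hy, hxy⟩
    obtain ⟨x', hx', hxd⟩ := hV.exists_mem_diffSet hV' hx
    obtain ⟨y', hy', hyd⟩ := hV.exists_mem_diffSet hV' hy
    have hne : x' ≠ y' := by
      rintro rfl
      exact hxy ((MulAction.orbit_eq_iff.2 hx').symm.trans (MulAction.orbit_eq_iff.2 hy'))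
    have := hT.subsingleton_H1 hne
      (EMA.eq_zero_of_invariant ((hV.mem_diffSet_iff hs hV' x').1 hxd))
      (EMA.eq_zero_of_invariant ((hV.mem_diffSet_iff hs hV' y').1 hyd))
    exact ((EMA.ext1LinearEquiv _ _ _ _).trans
      (EMA.H1.congr EMA.tensorHomEquiv).symm).toEquiv.subsingleton
  · intro x₀ hx₀
    have hiso : ∀ x : s, x ≠ x₀ →
        Nonempty (EMA.EvalAt x.1 (V x) ≃ₗ⁅k, EMA.mapAlgebra k A g Γ⁆ EMA.EvalAt x.1 (V' x)) :=
      fun x hx => by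
        rw [← not_isEmpty_iff, ← hV.mem_diffSet_iff hs hV', hx₀]
        exact hs.notMem_orbit hx
    let u : ∀ x : s, EMA.EvalAt x.1 (V x) →ₗ[k] EMA.EvalAt x.1 (V' x) := fun x =>
      if h : x = x₀ then 0 else (hiso x h).some.toLinearEquiv
    let τ : ∀ x : s, Module.Dual k (EMA.EvalAt x.1 (V x) →ₗ[k] EMA.EvalAt x.1 (V' x)) := fun x =>
      if h : x = x₀ then 0 else EMA.traceForm (hiso x h).some
    obtain ⟨E⟩ := hT.nonempty_H1_equiv_factor x₀
      (EMA.eq_zero_of_invariant ((hV.mem_diffSet_iff hs hV' x₀).1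
        (hx₀ ▸ MulAction.mem_orbit_self x₀.1))) u τ fun x hx => by
        simp only [u, τ, dif_neg hx]
        exact EMA.isSplitUnit_of_equiv _
    exact ⟨((EMA.ext1LinearEquiv _ _ _ _).trans (EMA.H1.congr EMA.tensorHomEquiv).symm).trans
      (E.trans (EMA.ext1LinearEquiv _ _ _ _).symm)⟩
  · rintro rfl
    have hiso : ∀ x : s,
        Nonempty (EMA.EvalAt x.1 (V x) ≃ₗ⁅k, EMA.mapAlgebra k A g Γ⁆ EMA.EvalAt x.1 (V' x)) :=
      fun x => by
        rw [← not_isEmpty_iff, ← hV.mem_diffSet_iff hs hV']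
        exact fun h => h rfl
    refine ⟨⟨EMA.tensorCongr fun x => (hiso x).some⟩, fun hne => ?_⟩
    have : Nonempty s := hne.to_subtype
    obtain ⟨T', hT'⟩ := EMA.exists_isSeparating (g := g) hs V V
    obtain ⟨E⟩ := hT'.nonempty_prod_H1_equiv _ _ fun x =>
      EMA.isSplitUnit_of_equiv (LieModuleEquiv.refl : EMA.EvalAt x.1 (V x) ≃ₗ⁅k, _⁆ _)
    rw [Fintype.card_coe] at E
    exact ⟨((LinearEquiv.refl k _).prodCongr ((EMA.ext1LinearEquiv _ _ _ _).trans
      (EMA.H1.congr EMA.tensorHomEquiv).symm)).trans <| E.trans <|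
      LinearEquiv.piCongrRight fun x => (EMA.ext1LinearEquiv _ _ _ _).symm⟩
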